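/- **Problem.** Let $m\ge 1$, $f:\mathbb R^n\to\mathbb R$, $A\in\mathbb R^{m\times n}$, $\mathbf b\in\mathbb R^m$, $\lambda>0$, and let $h(\mathbf u):=\|\mathbf u_+\|_0$ be the number of positive entries of $\mathbf u\in\mathbb R^m$. Consider $$\min_{\mathbf x,\mathbf u}\ f(\mathbf x)+\lambda h(\mathbf u)\quad\text{s.t.}\quad A\mathbf x+\mathbf b=\mathbf u .$$ Write $\mathcal L_\rho(\mathbf x,\mathbf u,\mathbf y)=f(\mathbf x)+\langle \mathbf y,A\mathbf x+\mathbf b-\mathbf u\rangle+\frac\rho2\|A\mathbf x+\mathbf b-\mathbf u\|^2+\lambda h(\mathbf u)$ and $\mathcal V_{\rho,\beta}(\mathbf x,\mathbf u,\mathbf y,\mathbf v)=\mathcal L_\rho(\mathbf x,\mathbf u,\mathbf y)+\frac\beta2\|\mathbf x-\mathbf v\|^2$. For $\mathbf p\in\mathbb R^m$, $\mathbf q\in\mathbb R^n$ let $$g(\mathbf x,\mathbf u)=f(\mathbf x)+\langle \mathbf p,A\mathbf x+\mathbf b-\mathbf u\rangle+\tfrac\rho2\|A\mathbf x+\mathbf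 b-\mathbf u\|^2+\tfrac\mu2\|\mathbf x-\mathbf q\|^2,\qquad G=g+\lambda h .$$ For $\alpha>0$ let $\mathrm{Prox}_{\alpha\lambda h}(\mathbf w)$ and $\Phi_{\alpha\lambda h}(\mathbf w)$ be the set of minimizers and the minimum value over $\mathbf z\in\mathbb R^m$ of $\alpha\lambda h(\mathbf z)+\frac12\|\mathbf z-\mathbf w\|^2$. The active set at $(\mathbf x,\mathbf u)$ is $\Gamma(\mathbf x,\mathbf u)=\{i:[\mathbf u-\alpha\nabla_{\mathbf u}g(\mathbf x,\mathbf u)]_i\in[0,\sqrt{2\alpha\lambda})\}$, and $\overline\Gamma$ is its complement. **Assumptions.** (i) $f$ is $C^2$, $f+\frac{\sigma_f}2\|\cdot\|^2$ is convex, $\nabla f$ is $\ell_f$-Lipschitz and $\nabla^2f$ is $L_f$-Lipschitz. (ii) $A$ has full row rank; $\gamma>0$ and $\gamma^2$ is the smallest eigenvalue of $AA^\top$. (iii) $f$ is coercive: $f(\mathbf x)\to\infty$ as $\|\mathbf x\|\to\infty$. (iv) $\mu>0$, $\mu>\sigma_f$, $c_1,c_2>0$, $\epsilon_k>0$, $\epsilon_k\to0$,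 and with $c_3=\frac{\mu+\ell_f+c_1}{\gamma}$, $c_4=\frac{\mu+c_1}{\gamma}$, $$\rho>\max\Big\{\frac{8(c_3^2+c_4^2)}{\mu},\frac{4\ell_f}{\gamma^2}\Big\},\qquad \beta=\frac{4c_4^2}{\rho}.$$ (v) $\ell_g>0$ is a Lipschitz modulus of $\nabla g$ on $\mathbb R^n\times\mathbb R^m$ (uniform in $\mathbf p,\mathbf q$), $0<\alpha<1/\ell_g$ and $0<t<2/\ell_g$. Put $\sigma_g=\mu-\sigma_f$. **GSNewton** (for given $\mathbf p,\mathbf q$). From $\zeta^j=(\mathbf x^j,\mathbf u^j)$ with $\Gamma_j=\Gamma(\zeta^j)$, let $u^{j+1/2}_i=0$ for $i\in\Gamma_j$ and $u^{j+1/2}_i=[\mathbf u^j-\alpha\nabla_{\mathbf u}g(\zeta^j)]_i$ for $i\notin\Gamma_j$, and let $\mathbf x^{j+1/2}=\mathbf x^j-t\nabla_{\mathbf x}g(\mathbf x^j,\mathbf u^{j+1/2})$. Let $\widetilde\zeta=(\widetilde{\mathbf x},\widetilde{\mathbf u})$ solve the truncated Newton equation: $\widetilde{\mathbf u}_{\Gamma_j}=0$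 and $$\begin{bmatrix}\nabla^2f(\mathbf x^{j+1/2})+\rho A^\top A+\mu I&-\rho A_{\overline\Gamma_j}^\top\\-\rho A_{\overline\Gamma_j}&\rho I\end{bmatrix}\begin{bmatrix}\widetilde{\mathbf x}-\mathbf x^{j+1/2}\\(\widetilde{\mathbf u}-\mathbf u^{j+1/2})_{\overline\Gamma_j}\end{bmatrix}=-\begin{bmatrix}\nabla_{\mathbf x}g(\zeta^{j+1/2})\\(\nabla_{\mathbf u}g(\zeta^{j+1/2}))_{\overline\Gamma_j}\end{bmatrix}.$$ Set $\zeta^{j+1}=\widetilde\zeta$ if $G(\zeta^{j+1/2})-G(\widetilde\zeta)\ge\frac{\sigma_g}4\|\widetilde\zeta-\zeta^{j+1/2}\|^2$, and $\zeta^{j+1}=\zeta^{j+1/2}$ otherwise. **iNALM.** Given $(\mathbf x^0,\mathbf u^0,\mathbf y^0)$, for $k=0,1,\dots$ run GSNewton with $\mathbf p=\mathbf y^k$, $\mathbf q=\mathbf x^k$ (so $g=g_k$) from $(\mathbf x^k,\mathbf u^k)$, and let $(\mathbf x^{k+1},\mathbf u^{k+1})$ be its first iterate $(\mathbf x,\mathbf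 u)$ such that, with $\Gamma=\Gamma(\mathbf x,\mathbf u)$, $$\begin{aligned}&\|\nabla_{\mathbf x}g_k(\mathbf x,\mathbf u)\|\le c_1\|\mathbf x-\mathbf x^k\|,\qquad \|[\mathbf u_\Gamma;\alpha(\nabla_{\mathbf u}g_k(\mathbf x,\mathbf u))_{\overline\Gamma}]\|\le c_2\|\mathbf x-\mathbf x^k\|^2,\\&\tfrac{\alpha^2}2\|\nabla_{\mathbf u}g_k(\mathbf x,\mathbf u)\|^2+\alpha\lambda h(\mathbf u)-\Phi_{\alpha\lambda h}(\mathbf u-\alpha\nabla_{\mathbf u}g_k(\mathbf x,\mathbf u))\le\epsilon_k .\end{aligned}$$ If no iterate passes this test and the $\mathbf x$-iterates of GSNewton converge to $\mathbf x^k$, take instead $\mathbf x^{k+1}=\mathbf x^k$ and $\mathbf u^{k+1}$ such that $\nabla_{\mathbf x}g_k=0$ and $\mathbf u^{k+1}\in\mathrm{Prox}_{\alpha\lambda h}(\mathbf u^{k+1}-\alpha\nabla_{\mathbf u}g_k)$ at $(\mathbf x^{k+1},\mathbf u^{k+1})$, the test is passed there, and $\mathcal V_{\rho,\mu}(\mathbf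 x^{k+1},\mathbf u^{k+1},\mathbf y^k,\mathbf x^k)\le\mathcal V_{\rho,\mu}(\mathbf x^k,\mathbf u^k,\mathbf y^k,\mathbf x^k)$. Then set $\mathbf y^{k+1}=\mathbf y^k+\rho(A\mathbf x^{k+1}+\mathbf b-\mathbf u^{k+1})$. **Theorem.** Let $\{(\mathbf x^k,\mathbf u^k,\mathbf y^k)\}$ be an (infinite) sequence generated by iNALM and let $(\mathbf x^*,\mathbf u^*,\mathbf y^*)$ be one of its accumulation points, at which the second-order sufficient condition holds: $$\mathbf d^\top\nabla^2f(\mathbf x^*)\mathbf d>0\quad\text{for all }\mathbf d\ne0\text{ with }(A\mathbf d)_i=0\text{ if }u_i^*=0,\,y_i^*>0,\ \text{ and }(A\mathbf d)_i\le0\text{ if }u^*_i=0,\,y^*_i=0 .$$ Put $\mathcal V_k=\mathcal V_{\rho,\beta}(\mathbf x^k,\mathbf u^k,\mathbf y^k,\mathbf x^{k-1})$ for $k\ge1$ and $\mathcal V_*=\mathcal V_{\rho,\beta}(\mathbf x^*,\mathbf u^*,\mathbf y^*,\mathbf x^*)$. Then the Lyapunov sequence converges R-linearly: there are an index $k_\nu\ge1$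 and constants $c_\nu>0$ and $q\in(0,1)$ such that $$0\le\mathcal V_k-\mathcal V_*\le c_\nu q^k\qquad\text{for all }k\ge k_\nu .$$ -/

import Mathlib

open Filter Topology

noncomputable section

namespace ZeroOneALM

/-- Euclidean space of dimension `n`, with its Euclidean norm. -/
abbrev E (n : ℕ) : Type := EuclideanSpace ℝ (Fin n)

/-- The data of the zero-one composite problem: minimize `f x + lam * h (A x + b)`, equivalently
minimize `f x + lam * h u` subject to `A x + b = u`. -/
structure COP (n m : ℕ) where
  f : E n → ℝ
  lam : ℝ
  A : Matrix (Fin m) (Fin n) ℝ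
  b : E m

/-- The parameters of the algorithm: penalty `rho`, proximal constant `mu`, steplengths `alpha` (in
`u`) and `t` (in `x`), the constant `sigmaG` of the acceptance test for Newton steps, and the
constants `c1`, `c2` and tolerances `eps k` of the termination test. -/
structure Params where
  rho : ℝ
  mu : ℝ
  alpha : ℝ
  t : ℝ
  sigmaG : ℝ
  c1 : ℝ
  c2 : ℝ
  eps : ℕ → ℝ

variable {n m : ℕ}

/-- The zero-one loss: the number of positive entries of `u`. -/
def h (u : E m) : ℝ := ((Finset.univ.filter (fun i => 0 < u i)).card : ℝ)

/-- The Moreau envelope of `c * h`. The infimum is over a nonempty set of reals that is bounded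
below by `0` when `0 ≤ c`. -/
def moreauH (c : ℝ) (w : E m) : ℝ := ⨅ z : E m, (c * h z + 1 / 2 * ‖z - w‖ ^ 2)

/-- The proximal operator of `c * h`, a set of minimizers. -/
def proxH (c : ℝ) (w : E m) : Set (E m) :=
  {u | ∀ z : E m, c * h u + 1 / 2 * ‖u - w‖ ^ 2 ≤ c * h z + 1 / 2 * ‖z - w‖ ^ 2}

/-- The Hessian of `f` as a linear operator: the derivative of the gradient. -/
def hessian (f : E n → ℝ) (x : E n) : E n →L[ℝ] E n := fderiv ℝ (gradient f) x

/-- `f` is twice continuously differentiable and `sigma`-weakly convex, with `ell`-Lipschitz gradient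
and `L`-Lipschitz Hessian (for the operator norm). -/
structure SmoothWeaklyConvex (f : E n → ℝ) (sigma ell L : ℝ) : Prop where
  contDiff : ContDiff ℝ 2 f
  weaklyConvex : ConvexOn ℝ Set.univ (fun x => f x + sigma / 2 * ‖x‖ ^ 2)
  lipGradient : ∀ x z : E n, ‖gradient f x - gradient f z‖ ≤ ell * ‖x - z‖
  lipHessian : ∀ x z : E n, ‖hessian f x - hessian f z‖ ≤ L * ‖x - z‖

namespace COP

/-- `A x + b - u`. -/
def gap (P : COP n m) (x : E n) (u : E m) : E m := Matrix.toEuclideanLin P.A x + P.b - u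

/-- The augmented Lagrange function. -/
def augLagrangian (P : COP n m) (rho : ℝ) (x : E n) (u y : E m) : ℝ :=
  P.f x + inner ℝ y (P.gap x u) + rho / 2 * ‖P.gap x u‖ ^ 2 + P.lam * h u

/-- The Lyapunov function. -/
def lyapunov (P : COP n m) (rho beta : ℝ) (x : E n) (u y : E m) (v : E n) : ℝ :=
  P.augLagrangian rho x u y + beta / 2 * ‖x - v‖ ^ 2

/-- The smooth part `g` of the subproblem with multiplier `p` and proximal centre `q`. -/
def g (P : COP n m) (rho mu : ℝ) (p : E m) (q : E n) (x : E n) (u : E m) : ℝ :=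
  P.f x + inner ℝ p (P.gap x u) + rho / 2 * ‖P.gap x u‖ ^ 2 + mu / 2 * ‖x - q‖ ^ 2

/-- The objective `G = g + lam * h` of the subproblem. -/
def G (P : COP n m) (rho mu : ℝ) (p : E m) (q : E n) (x : E n) (u : E m) : ℝ :=
  P.g rho mu p q x u + P.lam * h u

/-- The partial gradient of `g` in `x`. -/
def gradX (P : COP n m) (rho mu : ℝ) (p : E m) (q : E n) (x : E n) (u : E m) : E n :=
  gradient (fun x' => P.g rho mu p q x' u) x

/-- The partial gradient of `g` in `u`. -/
def gradU (P : COP n m) (rho mu : ℝ) (p : E m) (q : E n) (x : E n) (u : E m) : E m :=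
  gradient (fun u' => P.g rho mu p q x u') u

/-- `ell` is a Lipschitz modulus, for the Euclidean norm of `ℝⁿ × ℝᵐ`, of the gradient of `g`,
uniformly in the multiplier and the proximal centre. -/
def LipGradG (P : COP n m) (rho mu ell : ℝ) : Prop :=
  ∀ (p : E m) (q : E n) (x x' : E n) (u u' : E m),
    Real.sqrt (‖P.gradX rho mu p q x u - P.gradX rho mu p q x' u'‖ ^ 2
        + ‖P.gradU rho mu p q x u - P.gradU rho mu p q x' u'‖ ^ 2)
      ≤ ell * Real.sqrt (‖x - x'‖ ^ 2 + ‖u - u'‖ ^ 2)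

/-- The active set at `(x, u)`: the indices `i` with `[u + α y]_i ∈ [0, √(2 α lam))`, where
`y = -∇_u g(x, u)`. -/
def activeSet (P : COP n m) (S : Params) (p : E m) (q : E n) (x : E n) (u : E m) :
    Set (Fin m) :=
  {i | (u - S.alpha • P.gradU S.rho S.mu p q x u) i
    ∈ Set.Ico 0 (Real.sqrt (2 * S.alpha * P.lam))}

open Classical in
/-- The `u`-part of the gradient half-step. -/
def halfU (P : COP n m) (S : Params) (p : E m) (q : E n) (x : E n) (u : E m) : E m :=
  WithLp.toLp 2 fun i =>
    if i ∈ P.activeSet S p q x u then 0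
    else (u - S.alpha • P.gradU S.rho S.mu p q x u) i

/-- The `x`-part of the gradient half-step. -/
def halfX (P : COP n m) (S : Params) (p : E m) (q : E n) (x : E n) (u : E m) : E n :=
  x - S.t • P.gradX S.rho S.mu p q x (P.halfU S p q x u)

open Classical in
/-- The truncated Newton equation at the point `(x, u)` for the index set `Gam`, in block form:
`(xN, uN)` solves it if `uN` vanishes on `Gam` and
`(∇²f(x) + rho AᵀA + mu I) dx - rho (A_T)ᵀ du_T = -∇_x g(x, u)`,
`- rho A_T dx + rho du_T = -(∇_u g(x, u))_T`,
where `T` is the complement of `Gam`, `dx = xN - x` and `du = uN - u`. -/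
def IsNewtonPoint (P : COP n m) (S : Params) (p : E m) (q : E n) (Gam : Set (Fin m))
    (x : E n) (u : E m) (xN : E n) (uN : E m) : Prop :=
  (hessian P.f x (xN - x)
      + S.rho • Matrix.toEuclideanLin P.A.transpose (Matrix.toEuclideanLin P.A (xN - x))
      + S.mu • (xN - x)
      - S.rho • Matrix.toEuclideanLin P.A.transpose
          (WithLp.toLp 2 fun i => if i ∈ Gam then 0 else (uN - u) i)
    = - P.gradX S.rho S.mu p q x u) ∧
  (∀ i, i ∉ Gam →
    - S.rho * (Matrix.toEuclideanLin P.A (xN - x)) i + S.rho * (uN - u) i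
      = - (P.gradU S.rho S.mu p q x u) i) ∧
  (∀ i, i ∈ Gam → uN i = 0)

/-- The acceptance test for the Newton point `(xN, uN)` computed from `(x, u)`. -/
def NewtonAccepted (P : COP n m) (S : Params) (p : E m) (q : E n)
    (x : E n) (u : E m) (xN : E n) (uN : E m) : Prop :=
  S.sigmaG / 4 * (‖xN - x‖ ^ 2 + ‖uN - u‖ ^ 2)
    ≤ P.G S.rho S.mu p q x u - P.G S.rho S.mu p q xN uN

/-- One iteration of the gradient-subspace-Newton method, from `z` to `z'`. -/
def GSNewtonStep (P : COP n m) (S : Params) (p : E m) (q : E n) (z z' : E n × E m) : Prop :=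
  ∃ (xN : E n) (uN : E m),
    P.IsNewtonPoint S p q (P.activeSet S p q z.1 z.2)
      (P.halfX S p q z.1 z.2) (P.halfU S p q z.1 z.2) xN uN ∧
    ((P.NewtonAccepted S p q (P.halfX S p q z.1 z.2) (P.halfU S p q z.1 z.2) xN uN ∧
        z' = (xN, uN)) ∨
      (¬ P.NewtonAccepted S p q (P.halfX S p q z.1 z.2) (P.halfU S p q z.1 z.2) xN uN ∧
        z' = (P.halfX S p q z.1 z.2, P.halfU S p q z.1 z.2)))

/-- `z` is the sequence generated by the gradient-subspace-Newton method from `z 0`. -/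
def IsGSNewtonRun (P : COP n m) (S : Params) (p : E m) (q : E n) (z : ℕ → E n × E m) : Prop :=
  ∀ j, P.GSNewtonStep S p q (z j) (z (j + 1))

/-- The residual of the `x`-stationarity. -/
def R1 (P : COP n m) (S : Params) (p : E m) (q : E n) (x : E n) (u : E m) : ℝ :=
  ‖P.gradX S.rho S.mu p q x u‖

open Classical in
/-- The residual of the complementarity: the norm of the vector with entries `u i` for `i` in the
active set and `α (∇_u g) i` for the other `i`. -/
def R2 (P : COP n m) (S : Params) (p : E m) (q : E n) (x : E n) (u : E m) : ℝ :=
  ‖(WithLp.toLp 2 fun i =>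
    if i ∈ P.activeSet S p q x u then u i
    else S.alpha * P.gradU S.rho S.mu p q x u i : E m)‖

/-- The residual in terms of the Moreau envelope. -/
def R3 (P : COP n m) (S : Params) (p : E m) (q : E n) (x : E n) (u : E m) : ℝ :=
  S.alpha ^ 2 / 2 * ‖P.gradU S.rho S.mu p q x u‖ ^ 2 + S.alpha * P.lam * h u
    - moreauH (S.alpha * P.lam) (u - S.alpha • P.gradU S.rho S.mu p q x u)

/-- The termination test of the subproblem with proximal centre `q` at the outer iteration `k`. -/
def Terminates (P : COP n m) (S : Params) (k : ℕ) (p : E m) (q : E n) (z : E n × E m) : Prop :=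
  P.R1 S p q z.1 z.2 ≤ S.c1 * ‖z.1 - q‖ ∧
  P.R2 S p q z.1 z.2 ≤ S.c2 * ‖z.1 - q‖ ^ 2 ∧
  P.R3 S p q z.1 z.2 ≤ S.eps k

/-- `(x, u)` is a P-stationary point of the subproblem, with steplength `alpha`. -/
def SubPStationary (P : COP n m) (S : Params) (p : E m) (q : E n) (z : E n × E m) : Prop :=
  P.gradX S.rho S.mu p q z.1 z.2 = 0 ∧
  z.2 ∈ proxH (S.alpha * P.lam) (z.2 - S.alpha • P.gradU S.rho S.mu p q z.1 z.2)

/-- The primal step at the outer iteration `k`, from `(x, u)` with multiplier `y` to `z'`. The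
gradient-subspace-Newton method is started at `(x, u)` and stopped at the first iterate that passes
the termination test. If no iterate does and the `x`-iterates converge to the starting point `x`
itself, then `z'` is a P-stationary point `(x, u')` of the subproblem which passes the termination
test and does not increase the objective of the subproblem. -/
def PrimalStep (P : COP n m) (S : Params) (k : ℕ) (x : E n) (u y : E m) (z' : E n × E m) : Prop :=
  ∃ z : ℕ → E n × E m, z 0 = (x, u) ∧ P.IsGSNewtonRun S y x z ∧
    ((∃ j, P.Terminates S k y x (z j) ∧ (∀ i < j, ¬ P.Terminates S k y x (z i)) ∧ z' = z j) ∨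
      ((∀ j, ¬ P.Terminates S k y x (z j)) ∧ Tendsto (fun j => (z j).1) atTop (𝓝 x) ∧
        z'.1 = x ∧ P.SubPStationary S y x z' ∧ P.Terminates S k y x z' ∧
        P.lyapunov S.rho S.mu z'.1 z'.2 y x ≤ P.lyapunov S.rho S.mu x u y x))

/-- `(x k, u k, y k)` is generated by the inexact Newton augmented Lagrangian method. -/
def IsINALM (P : COP n m) (S : Params) (x : ℕ → E n) (u y : ℕ → E m) : Prop :=
  ∀ k, P.PrimalStep S k (x k) (u k) (y k) (x (k + 1), u (k + 1)) ∧
    y (k + 1) = y k + S.rho • P.gap (x (k + 1)) (u (k + 1))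

/-- The critical cone, in the `x`-variables, at a point with components `us` and multiplier `ys`. -/
def criticalCone (P : COP n m) (us ys : E m) : Set (E n) :=
  {d | (∀ i, us i = 0 → 0 < ys i → (Matrix.toEuclideanLin P.A d) i = 0) ∧
    (∀ i, us i = 0 → ys i = 0 → (Matrix.toEuclideanLin P.A d) i ≤ 0)}

/-- The second-order sufficient condition. -/
def SOSC (P : COP n m) (xs : E n) (us ys : E m) : Prop :=
  ∀ d ∈ P.criticalCone us ys, d ≠ 0 → 0 < inner ℝ d (hessian P.f xs d)

end COP

end ZeroOneALM

end

open ZeroOneALM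

/-! The inner method never increases the subproblem objective, so each outer step lowers the
augmented Lagrangian at the old multiplier by at least `mu / 2` times the squared `x`-step. The
multiplier update costs `‖Δy‖² / rho`. Since `Aᵀ` is bounded below by `gamma`, approximate
stationarity at two consecutive iterates bounds `‖Δy‖` by the last two `x`-steps. For large `rho`
this cost is absorbed, and the Lyapunov function drops by `mu / 4 * ‖x (k + 1) - x k‖²`
(`StepBounds.lyapunov_add_le`). It is bounded below because of the cluster point, hence the steps
vanish.

Let `e k` be the sum of the last two step lengths. Infeasibility and stationarity residual are `O(e
k)`, while for each index `u i` or `y i` is `O(e k ^ 2)` (`OuterRun.exists_residual_bound`). The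
proximal residual forces `h (u k) = h us` near the cluster point, which fixes the positive entries
of `u k`.

The second-order condition turns residuals into distances: `‖x k - xs‖ ≤ C * e k` near the cluster
point (`SOSC.exists_norm_sub_le`). Otherwise the normalized differences of `x` and `y` have limits
`d ≠ 0` and `η` with `d` critical, `Aᵀ η = -∇²f d` and `⟨A d, η⟩ = 0`, so `⟨d, ∇²f d⟩ = 0`.
Vanishing steps then keep the iterates near the point, and the whole sequence converges.

Finally, the Lyapunov excess is `O(e k ^ 2)`: the first-order terms are products of two `O(e k)`
quantities or complementarity products (`exists_augLagrangian_sub_le`). By the sufficient decrease,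
`e k ^ 2` is bounded by the decrease over two steps, which yields a geometric rate
(`exists_geometric_bound`). -/

namespace ZeroOneALM

variable {n m : ℕ}

/-! ### Linear algebra and the descent lemma -/

theorem inner_toEuclideanLin (A : Matrix (Fin m) (Fin n) ℝ) (x : E n) (y : E m) :
    inner ℝ (Matrix.toEuclideanLin A x) y = inner ℝ x (Matrix.toEuclideanLin A.transpose y) := by
  rw [← Matrix.conjTranspose_eq_transpose_of_trivial, Matrix.toEuclideanLin_conjTranspose_eq_adjoint,
    LinearMap.adjoint_inner_right]

/-- The square root of the least eigenvalue of `A Aᵀ` bounds `Aᵀ` from below. -/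
theorem le_norm_transpose {A : Matrix (Fin m) (Fin n) ℝ} {gamma : ℝ}
    (hleast : IsLeast
      {r : ℝ | Module.End.HasEigenvalue (Matrix.toLin' (A * A.transpose)) r} (gamma ^ 2))
    (y : E m) : gamma * ‖y‖ ≤ ‖Matrix.toEuclideanLin A.transpose y‖ := by
  have hH : (A * A.transpose - gamma ^ 2 • (1 : Matrix (Fin m) (Fin m) ℝ)).IsHermitian := by
    have h1 : (A * A.transpose).IsHermitian := by
      rw [← Matrix.conjTranspose_eq_transpose_of_trivial]
      exact Matrix.isHermitian_mul_conjTranspose_self A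
    refine h1.sub ?_
    simp [Matrix.IsHermitian]
  have hpos : (A * A.transpose - gamma ^ 2 • (1 : Matrix (Fin m) (Fin m) ℝ)).PosSemidef := by
    rw [hH.posSemidef_iff_eigenvalues_nonneg]
    intro i
    have hv := hH.mulVec_eigenvectorBasis i
    have hne : (hH.eigenvectorBasis i).ofLp ≠ 0 := by
      intro h0
      apply hH.eigenvectorBasis.orthonormal.ne_zero i
      ext j
      simpa using congrFun h0 j
    -- Eigenvalues of `A Aᵀ - gamma² I` are those of `A Aᵀ` shifted by `gamma²`, so minimality of
    -- `gamma²` makes them nonnegative.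
    have hmem : (hH.eigenvalues i + gamma ^ 2) ∈
        {r : ℝ | Module.End.HasEigenvalue (Matrix.toLin' (A * A.transpose)) r} := by
      refine Module.End.hasEigenvalue_of_hasEigenvector (x := (hH.eigenvectorBasis i).ofLp)
        ⟨Module.End.mem_eigenspace_iff.2 ?_, hne⟩
      rw [Matrix.toLin'_apply, add_smul, ← hv, Matrix.sub_mulVec, Matrix.smul_mulVec,
        Matrix.one_mulVec]
      abel
    have := hleast.2 hmem
    simpa using this
  have h2 := hpos.dotProduct_mulVec_nonneg y.ofLp
  have h3 : ‖Matrix.toEuclideanLin A.transpose y‖ ^ 2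
      = inner ℝ y (Matrix.toEuclideanLin (A * A.transpose) y) := by
    rw [← real_inner_self_eq_norm_sq, ← inner_toEuclideanLin]
    rw [real_inner_comm]
    simp [Matrix.toLpLin_apply, Matrix.mulVec_mulVec]
  have h4 : (gamma * ‖y‖) ^ 2 ≤ ‖Matrix.toEuclideanLin A.transpose y‖ ^ 2 := by
    rw [h3, mul_pow, ← real_inner_self_eq_norm_sq]
    simp only [EuclideanSpace.inner_eq_star_dotProduct, Matrix.toLpLin_apply]
    simp only [Matrix.sub_mulVec, Matrix.smul_mulVec, Matrix.one_mulVec, dotProduct_sub,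
      dotProduct_smul, star_trivial, smul_eq_mul] at h2 ⊢
    rw [dotProduct_comm (Matrix.mulVec _ _)]
    linarith
  exact le_of_sq_le_sq h4 (norm_nonneg _)

/-- The descent lemma, in its two-sided form. -/
theorem abs_sub_inner_gradient_le {F : E n → ℝ} {F' : E n → E n} {ell : ℝ}
    (hF : ∀ x, HasGradientAt F (F' x) x) (hlip : ∀ x z, ‖F' x - F' z‖ ≤ ell * ‖x - z‖)
    (x z : E n) : |F z - F x - inner ℝ (F' x) (z - x)| ≤ ell / 2 * ‖z - x‖ ^ 2 := by
  have hd : ∀ s : ℝ, HasDerivAt (fun s : ℝ => F (x + s • (z - x)) - F x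
      - s * inner ℝ (F' x) (z - x))
      (inner ℝ (F' (x + s • (z - x))) (z - x) - inner ℝ (F' x) (z - x)) s := by
    intro s
    have h1 : HasDerivAt (fun s : ℝ => x + s • (z - x)) (z - x) s := by
      simpa using ((hasDerivAt_id s).smul_const (z - x)).const_add x
    have h2 := (hasGradientAt_iff_hasFDerivAt.1 (hF (x + s • (z - x)))).comp_hasDerivAt s h1
    simp only [InnerProductSpace.toDual_apply_apply] at h2
    have h3 := (hasDerivAt_id s).mul_const (inner ℝ (F' x) (z - x))
    rw [one_mul] at h3
    exact (h2.sub_const (F x)).sub h3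
  -- The first-order remainder along the segment is compared with `ell / 2 * ‖z - x‖² * s²`; working
  -- with norms gives both signs at once.
  have key := image_norm_le_of_norm_deriv_right_le_deriv_boundary (a := 0) (b := 1)
    (f := fun s : ℝ => F (x + s • (z - x)) - F x - s * inner ℝ (F' x) (z - x))
    (f' := fun s => inner ℝ (F' (x + s • (z - x))) (z - x) - inner ℝ (F' x) (z - x))
    (B := fun s => ell / 2 * ‖z - x‖ ^ 2 * s ^ 2)
    (B' := fun s => ell * ‖z - x‖ ^ 2 * s)
    (fun s _ => (hd s).continuousAt.continuousWithinAt)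
    (fun s _ => (hd s).hasDerivWithinAt) (by simp)
    (fun s => by
      have := (hasDerivAt_pow 2 s).const_mul (ell / 2 * ‖z - x‖ ^ 2)
      refine this.congr_deriv ?_
      norm_num
      ring)
    (fun s hs => by
      rw [← inner_sub_left]
      refine (norm_inner_le_norm _ _).trans ?_
      have h1 := hlip (x + s • (z - x)) x
      rw [add_sub_cancel_left, norm_smul, Real.norm_of_nonneg hs.1] at h1
      calc _ ≤ (ell * (s * ‖z - x‖)) * ‖z - x‖ := by gcongr
        _ = _ := by ring)
    (Set.right_mem_Icc.2 zero_le_one)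
  simpa using key

theorem SmoothWeaklyConvex.hasGradientAt {f : E n → ℝ} {sigma ell L : ℝ}
    (hf : SmoothWeaklyConvex f sigma ell L) (x : E n) : HasGradientAt f (gradient f x) x :=
  ((hf.contDiff.differentiable (by norm_num)) x).hasGradientAt

theorem SmoothWeaklyConvex.hasFDerivAt_gradient {f : E n → ℝ} {sigma ell L : ℝ}
    (hf : SmoothWeaklyConvex f sigma ell L) (x : E n) :
    HasFDerivAt (gradient f) (hessian f x) x := by
  have h1 : Differentiable ℝ (fderiv ℝ f) :=
    (hf.contDiff.fderiv_right (m := 1) (by norm_num)).differentiable (by norm_num)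
  have h2 : DifferentiableAt ℝ (gradient f) x :=
    ((InnerProductSpace.toDual ℝ (E n)).symm.toContinuousLinearEquiv.differentiableAt).comp x (h1 x)
  exact h2.hasFDerivAt

theorem SmoothWeaklyConvex.continuous_gradient {f : E n → ℝ} {sigma ell L : ℝ}
    (hf : SmoothWeaklyConvex f sigma ell L) : Continuous (gradient f) :=
  continuous_iff_continuousAt.2 fun x => (hf.hasFDerivAt_gradient x).continuousAt

/-! ### Partial gradients of the smooth part -/

namespace COP

theorem hasGradientAt_g_left (P : COP n m) {sigma ell L : ℝ}
    (hf : SmoothWeaklyConvex P.f sigma ell L) (rho mu : ℝ) (p : E m) (q x : E n) (u : E m) :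
    HasGradientAt (fun x' => P.g rho mu p q x' u)
      (gradient P.f x + Matrix.toEuclideanLin P.A.transpose (p + rho • P.gap x u)
        + mu • (x - q)) x := by
  have h0 := hasGradientAt_iff_hasFDerivAt.1 (hf.hasGradientAt x)
  have h1 : HasFDerivAt (fun x' => P.gap x' u)
      (LinearMap.toContinuousLinearMap (Matrix.toEuclideanLin P.A)) x :=
    (((LinearMap.toContinuousLinearMap (Matrix.toEuclideanLin P.A)).hasFDerivAt).add_const
      P.b).sub_const u
  have h2 : HasFDerivAt (fun x' : E n => x' - q) (ContinuousLinearMap.id ℝ (E n)) x :=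
    (hasFDerivAt_id x).sub_const q
  have h3 := ((h0.add ((innerSL ℝ p).hasFDerivAt.comp x h1)).add
    (h1.norm_sq.const_mul (rho / 2))).add (h2.norm_sq.const_mul (mu / 2))
  rw [hasGradientAt_iff_hasFDerivAt]
  refine h3.congr_fderiv ?_
  ext v
  simp only [InnerProductSpace.toDual_apply_apply, _root_.add_apply,
    ContinuousLinearMap.comp_apply, _root_.smul_apply, innerSL_apply_apply,
    LinearMap.coe_toContinuousLinearMap', inner_add_left, inner_smul_left, smul_eq_mul,
    ContinuousLinearMap.id_apply, nsmul_eq_mul]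
  rw [real_inner_comm v (Matrix.toEuclideanLin P.A.transpose (p + rho • P.gap x u)),
    ← inner_toEuclideanLin, real_inner_comm v, inner_add_right, inner_smul_right,
    real_inner_comm p, real_inner_comm (P.gap x u)]
  simp
  ring

theorem gradX_eq (P : COP n m) {sigma ell L : ℝ}
    (hf : SmoothWeaklyConvex P.f sigma ell L) (rho mu : ℝ) (p : E m) (q x : E n) (u : E m) :
    P.gradX rho mu p q x u
      = gradient P.f x + Matrix.toEuclideanLin P.A.transpose (p + rho • P.gap x u)
        + mu • (x - q) :=
  (P.hasGradientAt_g_left hf rho mu p q x u).gradient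

theorem gradU_eq (P : COP n m) (rho mu : ℝ) (p : E m) (q x : E n) (u : E m) :
    P.gradU rho mu p q x u = -(p + rho • P.gap x u) := by
  refine HasGradientAt.gradient ?_
  have h1 : HasFDerivAt (fun u' => P.gap x u') (-ContinuousLinearMap.id ℝ (E m)) u :=
    (hasFDerivAt_id u).const_sub _
  have h3 := ((((innerSL ℝ p).hasFDerivAt.comp u h1).const_add (P.f x)).add
    (h1.norm_sq.const_mul (rho / 2))).add_const (mu / 2 * ‖x - q‖ ^ 2)
  rw [hasGradientAt_iff_hasFDerivAt]
  refine h3.congr_fderiv ?_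
  ext v
  simp
  ring

/-- An exact expansion, since `g` is quadratic in `u` with Hessian `rho I`. -/
theorem g_sub_g_right (P : COP n m) (rho mu : ℝ) (p : E m) (q x : E n) (u v : E m) :
    P.g rho mu p q x v = P.g rho mu p q x u + inner ℝ (P.gradU rho mu p q x u) (v - u)
      + rho / 2 * ‖v - u‖ ^ 2 := by
  have h1 : P.gap x v = P.gap x u - (v - u) := by unfold gap; abel
  rw [gradU_eq]
  unfold g
  rw [h1, inner_sub_right, norm_sub_sq_real, inner_neg_left, inner_add_left, inner_smul_left]
  simp
  ring

end COP

/-! ### The proximal operator of the zero-one loss -/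

theorem h_eq_sum (u : E m) : h u = ∑ i, if 0 < u i then (1 : ℝ) else 0 := by
  simp [h]

theorem h_nonneg (u : E m) : 0 ≤ h u := Nat.cast_nonneg _

/-- The hard thresholding operator selects a proximal point of `c * h`. -/
theorem mem_proxH_of_hardThreshold {c : ℝ} (hc : 0 < c) {v w : E m}
    (hin : ∀ i, w i ∈ Set.Ico 0 (Real.sqrt (2 * c)) → v i = 0)
    (hout : ∀ i, w i ∉ Set.Ico 0 (Real.sqrt (2 * c)) → v i = w i) : v ∈ proxH c w := by
  intro z
  rw [h_eq_sum, h_eq_sum, EuclideanSpace.norm_sq_eq, EuclideanSpace.norm_sq_eq]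
  simp only [Finset.mul_sum, ← Finset.sum_add_distrib]
  refine Finset.sum_le_sum fun i _ => ?_
  simp only [PiLp.sub_apply, Real.norm_eq_abs, sq_abs]
  have hs := Real.sq_sqrt (show 0 ≤ 2 * c by positivity)
  have hs0 := Real.sqrt_nonneg (2 * c)
  by_cases hi : w i ∈ Set.Ico 0 (Real.sqrt (2 * c))
  · rw [hin i hi]
    obtain ⟨h0, h1⟩ := hi
    rw [if_neg (lt_irrefl _)]
    split_ifs with hz
    -- A positive `z i` costs at least `c`, and `w i < √(2c)` gives `w i ^ 2 / 2 ≤ c`.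
    · nlinarith [sq_nonneg (z i - w i)]
    · nlinarith
  · rw [hout i hi, sub_self]
    have h2 := sq_nonneg (z i - w i)
    split_ifs with hw hz hz
    · nlinarith
    -- Here `z i ≤ 0 < w i`, so the distance term is at least `w i ^ 2 / 2 ≥ c`.
    · have h1 : Real.sqrt (2 * c) ≤ w i := by
        by_contra hlt
        exact hi ⟨hw.le, not_le.1 hlt⟩
      nlinarith
    · nlinarith
    · nlinarith

/-! ### Descent of the inner method -/

namespace COP

theorem halfU_mem_proxH (P : COP n m) {S : Params} (hlam : 0 < P.lam) (halpha : 0 < S.alpha)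
    (p : E m) (q x : E n) (u : E m) :
    P.halfU S p q x u
      ∈ proxH (S.alpha * P.lam) (u - S.alpha • P.gradU S.rho S.mu p q x u) := by
  refine mem_proxH_of_hardThreshold (mul_pos halpha hlam) (fun i hi => ?_) (fun i hi => ?_)
  · rw [← mul_assoc] at hi
    exact if_pos hi
  · rw [← mul_assoc] at hi
    exact if_neg hi

/-- Varying only `u` shows that the modulus dominates `rho`; the factor `‖v‖` keeps the statement
valid when `E m` is trivial. -/
theorem LipGradG.rho_mul_norm_le {P : COP n m} {rho mu ell : ℝ} (hlip : P.LipGradG rho mu ell)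
    (v : E m) : rho * ‖v‖ ≤ ell * ‖v‖ := by
  have h1 := hlip 0 0 0 0 v 0
  rw [gradU_eq, gradU_eq] at h1
  have h2 : -((0 : E m) + rho • P.gap 0 v) - -(0 + rho • P.gap 0 0) = rho • v := by
    unfold gap
    module
  rw [h2, norm_smul] at h1
  simp only [sub_self, norm_zero, ne_eq, OfNat.ofNat_ne_zero, not_false_eq_true, zero_pow,
    sub_zero, zero_add, Real.sqrt_sq (norm_nonneg v)] at h1
  calc rho * ‖v‖ ≤ ‖rho‖ * ‖v‖ := by gcongr; exact Real.le_norm_self rho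
    _ ≤ _ := (Real.le_sqrt (by positivity) (by positivity)).2 (by
      have := sq_nonneg ‖P.gradX rho mu 0 0 0 v - P.gradX rho mu 0 0 0 0‖; linarith)
    _ ≤ _ := h1

theorem LipGradG.norm_gradX_sub_le {P : COP n m} {rho mu ell : ℝ} (hlip : P.LipGradG rho mu ell)
    (p : E m) (q x x' : E n) (u : E m) :
    ‖P.gradX rho mu p q x u - P.gradX rho mu p q x' u‖ ≤ ell * ‖x - x'‖ := by
  have h1 := hlip p q x x' u u
  rw [sub_self u, norm_zero, zero_pow two_ne_zero, add_zero, Real.sqrt_sq (norm_nonneg _)] at h1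
  exact (Real.le_sqrt (by positivity) (by positivity)).2 (by
    have := sq_nonneg ‖P.gradU rho mu p q x u - P.gradU rho mu p q x' u‖; linarith) |>.trans h1

/-- The half-step minimizes the proximal model of `G` in `u`. Comparing with the old `u` leaves the
quadratic term `1 / 2 * ‖v - u‖²`, which dominates `alpha * rho / 2 * ‖v - u‖²` because `rho` is
effectively at most `ell` and `alpha * ell < 1`. -/
theorem G_halfU_le (P : COP n m) {S : Params} {ell : ℝ} (hlam : 0 < P.lam)
    (hlip : P.LipGradG S.rho S.mu ell) (hell : 0 < ell)
    (halpha : 0 < S.alpha) (halpha_lt : S.alpha < 1 / ell) (p : E m) (q x : E n) (u : E m) :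
    P.G S.rho S.mu p q x (P.halfU S p q x u) ≤ P.G S.rho S.mu p q x u := by
  have h1 := P.halfU_mem_proxH hlam halpha p q x u u
  set v := P.halfU S p q x u
  set d := P.gradU S.rho S.mu p q x u with hd
  rw [show v - (u - S.alpha • d) = (v - u) + S.alpha • d by abel,
    show u - (u - S.alpha • d) = S.alpha • d by abel, norm_add_sq_real, inner_smul_right,
    real_inner_comm] at h1
  unfold G
  rw [P.g_sub_g_right S.rho S.mu p q x u v, ← hd]
  have h2 := hlip.rho_mul_norm_le (v - u)
  have h3 : S.alpha * ell < 1 := by rwa [lt_div_iff₀ hell] at halpha_lt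
  have h4 := norm_nonneg (v - u)
  have h5 : S.alpha * (S.rho * ‖v - u‖ ^ 2) ≤ ‖v - u‖ ^ 2 := by
    calc S.alpha * (S.rho * ‖v - u‖ ^ 2) = S.alpha * (S.rho * ‖v - u‖) * ‖v - u‖ := by ring
      _ ≤ S.alpha * (ell * ‖v - u‖) * ‖v - u‖ := by gcongr
      _ = (S.alpha * ell) * ‖v - u‖ ^ 2 := by ring
      _ ≤ 1 * ‖v - u‖ ^ 2 := by gcongr
      _ = _ := one_mul _
  have h6 : S.alpha * (inner ℝ d (v - u) + S.rho / 2 * ‖v - u‖ ^ 2 + P.lam * h v)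
      ≤ S.alpha * (P.lam * h u) := by linarith
  have := le_of_mul_le_mul_left h6 halpha
  linarith

/-- For a gradient step of length `t` the descent lemma gives a decrease of at least `t * (1 - t *
ell / 2) * ‖∇ₓg‖²`, nonnegative for `t < 2 / ell`. -/
theorem G_halfX_le (P : COP n m) {S : Params} {sigma ellf L ell : ℝ}
    (hf : SmoothWeaklyConvex P.f sigma ellf L)
    (hlip : P.LipGradG S.rho S.mu ell) (hell : 0 < ell)
    (ht : 0 < S.t) (ht_lt : S.t < 2 / ell) (p : E m) (q x : E n) (u : E m) :
    P.G S.rho S.mu p q (P.halfX S p q x u) (P.halfU S p q x u)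
      ≤ P.G S.rho S.mu p q x (P.halfU S p q x u) := by
  set v := P.halfU S p q x u with hv
  have h1 := abs_sub_inner_gradient_le (F := fun x' => P.g S.rho S.mu p q x' v)
    (fun x' => by rw [P.gradX_eq hf]; exact P.hasGradientAt_g_left hf S.rho S.mu p q x' v)
    (fun a b => hlip.norm_gradX_sub_le p q a b v) x (P.halfX S p q x u)
  have h2 : P.halfX S p q x u - x = -(S.t • P.gradX S.rho S.mu p q x v) := by
    unfold halfX; abel
  rw [h2, norm_neg, norm_smul, inner_neg_right, inner_smul_right, real_inner_self_eq_norm_sq,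
    Real.norm_of_nonneg ht.le] at h1
  have h3 := le_of_abs_le h1
  have h4 : S.t * ell < 2 := by rwa [lt_div_iff₀ hell] at ht_lt
  have h5 : 0 ≤ S.t * (2 - S.t * ell) * ‖P.gradX S.rho S.mu p q x v‖ ^ 2 := by
    have : 0 ≤ 2 - S.t * ell := by linarith
    positivity
  unfold G
  nlinarith

/-- The hypotheses under which the gradient-subspace-Newton method is a descent method. -/
structure DescentParams (P : COP n m) (S : Params) (ell : ℝ) : Prop where
  lam_pos : 0 < P.lam
  lip : P.LipGradG S.rho S.mu ell
  ell_pos : 0 < ell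
  alpha_pos : 0 < S.alpha
  alpha_lt : S.alpha < 1 / ell
  t_pos : 0 < S.t
  t_lt : S.t < 2 / ell
  sigmaG_nonneg : 0 ≤ S.sigmaG

theorem GSNewtonStep.G_le {P : COP n m} {S : Params} {sigma ellf L ell : ℝ}
    (hf : SmoothWeaklyConvex P.f sigma ellf L) (hP : P.DescentParams S ell)
    {p : E m} {q : E n} {z z' : E n × E m} (hz : P.GSNewtonStep S p q z z') :
    P.G S.rho S.mu p q z'.1 z'.2 ≤ P.G S.rho S.mu p q z.1 z.2 := by
  have h1 := (P.G_halfX_le hf hP.lip hP.ell_pos hP.t_pos hP.t_lt p q z.1 z.2).trans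
    (P.G_halfU_le hP.lam_pos hP.lip hP.ell_pos hP.alpha_pos hP.alpha_lt p q z.1 z.2)
  obtain ⟨xN, uN, -, ⟨hacc, rfl⟩ | ⟨-, rfl⟩⟩ := hz
  · refine le_trans ?_ h1
    unfold NewtonAccepted at hacc
    have := hP.sigmaG_nonneg
    have h2 : 0 ≤ S.sigmaG / 4 * (‖xN - P.halfX S p q z.1 z.2‖ ^ 2
      + ‖uN - P.halfU S p q z.1 z.2‖ ^ 2) := by positivity
    dsimp only
    linarith
  · exact h1

theorem lyapunov_eq_G (P : COP n m) (rho mu : ℝ) (x : E n) (u y : E m) (v : E n) :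
    P.lyapunov rho mu x u y v = P.G rho mu y v x u := by
  unfold lyapunov augLagrangian G g
  ring

theorem PrimalStep.terminates_and_lyapunov_le {P : COP n m} {S : Params} {sigma ellf L ell : ℝ}
    (hf : SmoothWeaklyConvex P.f sigma ellf L) (hP : P.DescentParams S ell) {k : ℕ}
    {x : E n} {u y : E m} {z' : E n × E m} (hz : P.PrimalStep S k x u y z') :
    P.Terminates S k y x z' ∧
      P.lyapunov S.rho S.mu z'.1 z'.2 y x ≤ P.lyapunov S.rho S.mu x u y x := by
  obtain ⟨z, hz0, hrun, ⟨j, hj, -, rfl⟩ | ⟨-, -, -, -, hT, hle⟩⟩ := hz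
  · refine ⟨hj, ?_⟩
    rw [lyapunov_eq_G, lyapunov_eq_G]
    have hanti : Antitone fun j => P.G S.rho S.mu y x (z j).1 (z j).2 :=
      antitone_nat_of_succ_le fun i => (hrun i).G_le hf hP
    simpa [hz0] using hanti (Nat.zero_le j)
  · exact ⟨hT, hle⟩

/-! ### Estimates of one outer iteration -/

/-- The inequalities which one outer iteration, from `(x, u, y)` to `(x', u', y')`, guarantees. -/
structure StepBounds (P : COP n m) (S : Params) (eps : ℝ) (x : E n) (u y : E m)
    (x' : E n) (u' y' : E m) : Prop where
  multiplier : y' = y + S.rho • P.gap x' u'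
  stationary : ‖gradient P.f x' + Matrix.toEuclideanLin P.A.transpose y' + S.mu • (x' - x)‖
    ≤ S.c1 * ‖x' - x‖
  complementary : ∀ i, |u' i| ≤ S.c2 * ‖x' - x‖ ^ 2 ∨ S.alpha * |y' i| ≤ S.c2 * ‖x' - x‖ ^ 2
  proximal : ∀ z : E m, S.alpha ^ 2 / 2 * ‖y'‖ ^ 2 + S.alpha * P.lam * h u'
    ≤ eps + (S.alpha * P.lam * h z + 1 / 2 * ‖z - (u' + S.alpha • y')‖ ^ 2)
  descent : P.augLagrangian S.rho x' u' y + S.mu / 2 * ‖x' - x‖ ^ 2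
    ≤ P.augLagrangian S.rho x u y

theorem IsINALM.stepBounds {P : COP n m} {S : Params} {sigma ellf L ell : ℝ}
    (hf : SmoothWeaklyConvex P.f sigma ellf L) (hP : P.DescentParams S ell)
    {x : ℕ → E n} {u y : ℕ → E m} (hgen : P.IsINALM S x u y) (k : ℕ) :
    P.StepBounds S (S.eps k) (x k) (u k) (y k) (x (k + 1)) (u (k + 1)) (y (k + 1)) := by
  obtain ⟨hstep, hy⟩ := hgen k
  obtain ⟨⟨h1, h2, h3⟩, h4⟩ := hstep.terminates_and_lyapunov_le hf hP
  -- The multiplier update makes the new multiplier equal to `-∇_u g` at the new iterate, so the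
  -- termination test becomes a statement about the new triple.
  have hgU : P.gradU S.rho S.mu (y k) (x k) (x (k + 1)) (u (k + 1)) = -y (k + 1) := by
    rw [gradU_eq, ← hy]
  refine ⟨hy, ?_, fun i => ?_, fun z => ?_, ?_⟩
  · unfold R1 at h1
    rwa [P.gradX_eq hf, ← hy] at h1
  · unfold R2 at h2
    have h5 := (PiLp.norm_apply_le _ i).trans h2
    dsimp only at h5
    rw [hgU] at h5
    split_ifs at h5
    · exact Or.inl h5
    · refine Or.inr ?_
      simpa [abs_mul, abs_of_pos hP.alpha_pos] using h5
  · unfold R3 at h3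
    dsimp only at h3
    rw [hgU, norm_neg, smul_neg, sub_neg_eq_add] at h3
    have hc := mul_pos hP.alpha_pos hP.lam_pos
    have h6 : moreauH (S.alpha * P.lam) (u (k + 1) + S.alpha • y (k + 1))
        ≤ S.alpha * P.lam * h z + 1 / 2 * ‖z - (u (k + 1) + S.alpha • y (k + 1))‖ ^ 2 := by
      refine ciInf_le ⟨0, ?_⟩ z
      rintro _ ⟨w, rfl⟩
      have := h_nonneg w
      positivity
    linarith
  · unfold lyapunov at h4
    simpa using h4

end COP

/-! ### Convergence to a cluster point -/

/-- A sequence with vanishing steps converges to its cluster point, if its distance to that point is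
bounded by a null sequence whenever the sequence is close to the point. -/
theorem tendsto_of_mapClusterPt_of_dist_le {X : Type*} [PseudoMetricSpace X] {z : ℕ → X} {a : X}
    {e : ℕ → ℝ} (hacc : MapClusterPt a atTop z)
    (hstep : Tendsto (fun k => dist (z (k + 1)) (z k)) atTop (𝓝 0)) (he : Tendsto e atTop (𝓝 0))
    (hb : ∀ᶠ k in atTop ⊓ comap z (𝓝 a), dist (z k) a ≤ e k) : Tendsto z atTop (𝓝 a) := by
  rw [eventually_inf] at hb
  obtain ⟨s, hs, t, ht, hst⟩ := hb
  obtain ⟨v, hv, hvt⟩ := mem_comap.1 ht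
  obtain ⟨δ, hδ, hball⟩ := Metric.mem_nhds_iff.1 hv
  obtain ⟨K, hK⟩ := ((hstep.eventually (gt_mem_nhds (half_pos hδ))).and
    ((he.eventually (gt_mem_nhds (half_pos hδ))).and hs)).exists_forall_of_atTop
  have hle : ∀ k, K ≤ k → dist (z k) a < δ → dist (z k) a ≤ e k := fun k hk hd =>
    hst k ⟨(hK k hk).2.2, hvt (hball hd)⟩
  -- One late visit to the `δ`-ball suffices: there the distance is at most `e k < δ / 2`, and the
  -- next step is shorter than `δ / 2`, so the ball is never left.
  obtain ⟨k0, hk0, hk0'⟩ := ((mapClusterPt_iff_frequently.1 hacc _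
    (Metric.ball_mem_nhds a hδ)).and_eventually (eventually_ge_atTop K)).exists
  have hin : ∀ k, k0 ≤ k → dist (z k) a < δ := by
    intro k hk
    induction k, hk using Nat.le_induction with
    | base => exact hk0
    | succ k hk ih =>
      have h1 := hle k (hk0'.trans hk) ih
      have h2 := hK k (hk0'.trans hk)
      have h3 := dist_triangle (z (k + 1)) (z k) a
      linarith [h2.1, h2.2.1]
  rw [tendsto_iff_dist_tendsto_zero]
  refine squeeze_zero' (Eventually.of_forall fun _ => dist_nonneg) ?_ he
  filter_upwards [eventually_ge_atTop k0] with k hk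
  exact hle k (hk0'.trans hk) (hin k hk)

/-- Passing to an ultrafilter replaces the successive extraction of subsequences. -/
theorem exists_tendsto_of_eventually_norm_le {ι X : Type*} [NormedAddCommGroup X] [ProperSpace X]
    {U : Ultrafilter ι} {w : ι → X} {C : ℝ} (hw : ∀ᶠ k in (U : Filter ι), ‖w k‖ ≤ C) :
    ∃ l, Tendsto w U (𝓝 l) := by
  obtain ⟨l, -, hl⟩ := (isCompact_closedBall (0 : X) C).ultrafilter_le_nhds (U.map w)
    (le_principal_iff.2 (Ultrafilter.mem_map.2
      (hw.mono fun k hk => mem_closedBall_zero_iff.2 hk)))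
  exact ⟨l, hl⟩

theorem tendsto_apply {ι : Type*} {F : Filter ι} {w : ι → E m} {l : E m} (hw : Tendsto w F (𝓝 l))
    (i : Fin m) : Tendsto (fun k => w k i) F (𝓝 (l i)) :=
  ((EuclideanSpace.proj (𝕜 := ℝ) i).continuous.tendsto l).comp hw

/-! ### The error bound from the second-order condition -/

namespace COP

/-- The error bound which the second-order sufficient condition implies along any filter. -/
theorem SOSC.exists_norm_sub_le {P : COP n m} {xs : E n} {us ys : E m} (hSOSC : P.SOSC xs us ys)
    (hH : HasFDerivAt (gradient P.f) (hessian P.f xs) xs)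
    (hgaps : P.gap xs us = 0)
    (hstats : gradient P.f xs + Matrix.toEuclideanLin P.A.transpose ys = 0)
    {gamma : ℝ} (hgamma : 0 < gamma)
    (hinj : ∀ v : E m, gamma * ‖v‖ ≤ ‖Matrix.toEuclideanLin P.A.transpose v‖)
    {ι : Type*} {F : Filter ι} {x : ι → E n} {u y : ι → E m} {e : ι → ℝ}
    (hx : Tendsto x F (𝓝 xs)) (hu : Tendsto u F (𝓝 us)) (hy : Tendsto y F (𝓝 ys))
    (he : Tendsto e F (𝓝 0)) (he0 : ∀ k, 0 ≤ e k) {a : ℝ}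
    (hgap : ∀ᶠ k in F, ‖P.gap (x k) (u k)‖ ≤ a * e k)
    (hstat : ∀ᶠ k in F,
      ‖gradient P.f (x k) + Matrix.toEuclideanLin P.A.transpose (y k)‖ ≤ a * e k)
    (hcomp : ∀ᶠ k in F, ∀ i, |u k i| ≤ a * e k ^ 2 ∨ |y k i| ≤ a * e k ^ 2)
    (hsign : ∀ᶠ k in F, ∀ i, 0 < u k i → 0 < us i) :
    ∃ C, ∀ᶠ k in F, ‖x k - xs‖ ≤ C * e k := by
  by_contra! hcon
  -- If every constant fails, `e k / ‖x k - xs‖` has cluster point `0`; failure of the constant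
  -- `δ⁻¹` brings it below `δ`.
  have hclus : MapClusterPt 0 (F ⊓ 𝓟 {k | x k ≠ xs}) (fun k => ‖x k - xs‖⁻¹ * e k) := by
    rw [mapClusterPt_iff_frequently]
    intro s hs
    obtain ⟨δ, hδ, hball⟩ := Metric.mem_nhds_iff.1 hs
    rw [frequently_inf_principal]
    have h1 : ∃ᶠ k in F, δ⁻¹ * e k < ‖x k - xs‖ := by simpa using hcon δ⁻¹
    refine h1.mono fun k hk => ?_
    have hpos : 0 < ‖x k - xs‖ :=
      lt_of_le_of_lt (mul_nonneg (inv_nonneg.2 hδ.le) (he0 k)) hk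
    refine ⟨fun h0 => by simp [h0] at hpos, hball ?_⟩
    rw [Metric.mem_ball, dist_zero_right, Real.norm_of_nonneg
      (mul_nonneg (inv_nonneg.2 hpos.le) (he0 k)), inv_mul_lt_iff₀ hpos]
    rw [inv_mul_lt_iff₀ hδ] at hk
    linarith
  obtain ⟨U, hU, hte⟩ := mapClusterPt_iff_ultrafilter.1 hclus
  have hUF : (U : Filter ι) ≤ F := hU.trans inf_le_left
  have hne : ∀ᶠ k in (U : Filter ι), x k ≠ xs :=
    le_principal_iff.1 (hU.trans inf_le_right)
  clear hclus hcon hU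
  replace hx := hx.mono_left hUF
  replace hu := hu.mono_left hUF
  replace hy := hy.mono_left hUF
  replace he := he.mono_left hUF
  replace hgap := hgap.filter_mono hUF
  replace hstat := hstat.filter_mono hUF
  replace hcomp := hcomp.filter_mono hUF
  replace hsign := hsign.filter_mono hUF
  set t : ι → ℝ := fun k => ‖x k - xs‖⁻¹ with ht
  have ht0 : ∀ k, 0 ≤ t k := fun k => inv_nonneg.2 (norm_nonneg _)
  have hnorm : ∀ᶠ k in (U : Filter ι), ‖t k • (x k - xs)‖ = 1 := by
    filter_upwards [hne] with k hk
    rw [norm_smul, Real.norm_of_nonneg (ht0 k)]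
    exact inv_mul_cancel₀ (norm_ne_zero_iff.2 (sub_ne_zero.2 hk))
  obtain ⟨d, hd⟩ := exists_tendsto_of_eventually_norm_le (hnorm.mono fun k hk => hk.le)
  have hd1 : ‖d‖ = 1 :=
    tendsto_nhds_unique hd.norm (tendsto_const_nhds.congr' (hnorm.mono fun k hk => hk.symm))
  have hsmall : ∀ {X : Type} [NormedAddCommGroup X] [NormedSpace ℝ X] {w : ι → X},
      (∀ᶠ k in (U : Filter ι), ‖w k‖ ≤ a * e k) →
        Tendsto (fun k => t k • w k) U (𝓝 0) := by
    intro X _ _ w hw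
    refine squeeze_zero_norm' ?_ (by simpa using hte.const_mul a)
    filter_upwards [hw] with k hk
    rw [norm_smul, Real.norm_of_nonneg (ht0 k)]
    calc t k * ‖w k‖ ≤ t k * (a * e k) := by gcongr
      _ = _ := by ring
  have hgrad : Tendsto (fun k => t k • (gradient P.f (x k) - gradient P.f xs)) U
      (𝓝 (hessian P.f xs d)) := by
    have h1 := ((hH.isLittleO.comp_tendsto hx).norm_right).tendsto_inv_smul_nhds_zero
    have h2 := ((hessian P.f xs).continuous.tendsto d).comp hd
    have h3 := h1.add h2
    rw [zero_add] at h3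
    refine h3.congr fun k => ?_
    simp only [Function.comp_apply, map_smul, ← smul_add, sub_add_cancel, ht]
  have hAt : Tendsto (fun k => Matrix.toEuclideanLin P.A.transpose (t k • (y k - ys))) U
      (𝓝 (-hessian P.f xs d)) := by
    have h1 := (hsmall hstat).sub hgrad
    rw [zero_sub] at h1
    refine h1.congr fun k => ?_
    rw [map_smul, ← smul_sub, map_sub, eq_neg_of_add_eq_zero_left hstats]
    congr 1
    abel
  -- The images under `Aᵀ` converge and `Aᵀ` is bounded below, so the normalized multiplier
  -- differences are bounded.
  obtain ⟨η, hη⟩ : ∃ η, Tendsto (fun k => t k • (y k - ys)) U (𝓝 η) := by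
    refine exists_tendsto_of_eventually_norm_le (C := gamma⁻¹ * (‖-hessian P.f xs d‖ + 1)) ?_
    filter_upwards [hAt.norm.eventually (gt_mem_nhds (lt_add_one _))] with k hk
    rw [le_inv_mul_iff₀ hgamma]
    exact (hinj _).trans hk.le
  have hAη : Matrix.toEuclideanLin P.A.transpose η = -hessian P.f xs d :=
    tendsto_nhds_unique
      (((Matrix.toEuclideanLin P.A.transpose).continuous_of_finiteDimensional.tendsto η).comp hη) hAt
  have hAd : Tendsto (fun k => t k • (u k - us)) U (𝓝 (Matrix.toEuclideanLin P.A d)) := by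
    have h1 := (((Matrix.toEuclideanLin P.A).continuous_of_finiteDimensional.tendsto d).comp hd).sub
      (hsmall hgap)
    rw [sub_zero] at h1
    refine h1.congr fun k => ?_
    simp only [Function.comp_apply]
    rw [map_smul, ← smul_sub, ← sub_zero (P.gap (x k) (u k)), ← hgaps, map_sub]
    unfold gap
    congr 1
    abel
  have hquad : ∀ {w : ι → ℝ}, (∀ᶠ k in (U : Filter ι), |w k| ≤ a * e k ^ 2) →
      Tendsto w U (𝓝 0) ∧ Tendsto (fun k => t k * w k) U (𝓝 0) := by
    intro w hw
    constructor
    · exact squeeze_zero_norm' hw (by simpa using (he.pow 2).const_mul a)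
    · refine squeeze_zero_norm' ?_ (by simpa using (hte.mul he).const_mul a)
      filter_upwards [hw] with k hk
      rw [norm_mul, Real.norm_of_nonneg (ht0 k), Real.norm_eq_abs]
      calc t k * |w k| ≤ t k * (a * e k ^ 2) := by gcongr
        _ = _ := by ring
  -- For each index the ultrafilter selects one alternative of `hcomp`. The selected component
  -- vanishes in the limit, and so does its normalized difference.
  have halt : ∀ i, (us i = 0 ∧ Matrix.toEuclideanLin P.A d i = 0) ∨ (ys i = 0 ∧ η i = 0) := by
    have key : ∀ {w : ι → E m} {ws l : E m} (i : Fin m), Tendsto w U (𝓝 ws) →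
        Tendsto (fun k => t k • (w k - ws)) U (𝓝 l) →
        (∀ᶠ k in (U : Filter ι), |w k i| ≤ a * e k ^ 2) → ws i = 0 ∧ l i = 0 := by
      intro w ws l i hw hl hb
      obtain ⟨h1, h2⟩ := hquad hb
      have h3 := tendsto_nhds_unique (tendsto_apply hw i) h1
      refine ⟨h3, tendsto_nhds_unique (tendsto_apply hl i) (h2.congr fun k => ?_)⟩
      simp [h3]
    intro i
    rcases Ultrafilter.eventually_or.1 (hcomp.mono fun k hk => hk i) with hi | hi
    · exact Or.inl (key i hu hAd hi)
    · exact Or.inr (key i hy hη hi)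
  have hcone : d ∈ P.criticalCone us ys := by
    refine ⟨fun i _ hi => ?_, fun i hi _ => ?_⟩
    · rcases halt i with h1 | h1
      · exact h1.2
      · exact absurd h1.1 hi.ne'
    · refine le_of_tendsto (tendsto_apply hAd i) ?_
      filter_upwards [hsign] with k hk
      have : u k i ≤ 0 := by
        by_contra hpos
        exact absurd (hk i (not_le.1 hpos)) (by simp [hi])
      simpa [hi] using mul_nonpos_of_nonneg_of_nonpos (ht0 k) this
  have hpos := hSOSC d hcone (fun h0 => by simp [h0] at hd1)
  -- By `halt`, each summand of `⟨A d, η⟩` has a zero factor. Moving `A` across gives `⟨d, ∇²f(xs)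
  -- d⟩ = 0`, against `hpos`.
  have hzero : inner ℝ (Matrix.toEuclideanLin P.A d) η = (0 : ℝ) := by
    rw [PiLp.inner_apply]
    refine Finset.sum_eq_zero fun i _ => ?_
    rcases halt i with h1 | h1 <;> simp [h1.2]
  rw [inner_toEuclideanLin, hAη, inner_neg_right] at hzero
  linarith

end COP

/-! ### Geometric decay and local constancy of the loss -/

/-- A nonnegative sequence each of whose terms is bounded by a multiple of its decrease over two
steps converges R-linearly. -/
theorem exists_geometric_bound {a : ℕ → ℝ} {K : ℕ} {c : ℝ} (hc : 0 < c)
    (hrec : ∀ k, K ≤ k → a (k + 2) ≤ c * (a k - a (k + 2))) :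
    ∃ C q : ℝ, 0 < C ∧ 0 < q ∧ q < 1 ∧ ∀ k, K ≤ k → a k ≤ C * q ^ k := by
  -- The recursion contracts by `θ = c / (1 + c)` over two steps, hence the rate `√θ`; `C` must
  -- cover both starting values, and its summand `1` makes it positive.
  set θ : ℝ := c / (1 + c) with hθ
  have hθ0 : 0 < θ := by positivity
  have hθ1 : θ < 1 := by rw [hθ, div_lt_one (by positivity)]; linarith
  have hstep : ∀ k, K ≤ k → a (k + 2) ≤ θ * a k := by
    intro k hk
    have h1 := hrec k hk
    rw [hθ, div_mul_eq_mul_div, le_div_iff₀ (by positivity)]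
    linarith
  set q := Real.sqrt θ with hq
  have hq0 : 0 < q := Real.sqrt_pos.2 hθ0
  have hq1 : q < 1 := by rw [hq, Real.sqrt_lt' one_pos]; linarith
  have hq2 : q ^ 2 = θ := Real.sq_sqrt hθ0.le
  set C := |a K| / q ^ K + |a (K + 1)| / q ^ (K + 1) + 1 with hC
  have hA : 0 ≤ |a K| / q ^ K := by positivity
  have hB : 0 ≤ |a (K + 1)| / q ^ (K + 1) := by positivity
  refine ⟨C, q, by positivity, hq0, hq1, ?_⟩
  have hpair : ∀ k, K ≤ k → a k ≤ C * q ^ k ∧ a (k + 1) ≤ C * q ^ (k + 1) := by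
    intro k hk
    induction k, hk using Nat.le_induction with
    | base =>
      constructor
      · rw [← div_le_iff₀ (by positivity)]
        have := div_le_div_of_nonneg_right (le_abs_self (a K)) (pow_pos hq0 K).le
        linarith
      · rw [← div_le_iff₀ (by positivity)]
        have := div_le_div_of_nonneg_right (le_abs_self (a (K + 1))) (pow_pos hq0 (K + 1)).le
        linarith
    | succ k hk ih =>
      refine ⟨ih.2, (hstep k hk).trans ?_⟩
      calc θ * a k ≤ θ * (C * q ^ k) := by gcongr; exact ih.1
        _ = C * q ^ (k + 1 + 1) := by rw [← hq2]; ring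
  exact fun k hk => (hpair k hk).1

/-- Positive entries of the limit stay positive nearby, so `h` cannot drop; being integer-valued, it
cannot rise by less than one either. -/
theorem eventually_pos_iff_and_h_eq {ι : Type*} {F : Filter ι} {u : ι → E m} {us : E m}
    (hu : Tendsto u F (𝓝 us)) (hh : ∀ᶠ k in F, h (u k) < h us + 1) :
    ∀ᶠ k in F, (∀ i, 0 < u k i → 0 < us i) ∧ h (u k) = h us := by
  have h1 : ∀ᶠ k in F, ∀ i, 0 < us i → 0 < u k i := by
    rw [eventually_all]
    intro i
    by_cases hi : 0 < us i
    · filter_upwards [(tendsto_apply hu i).eventually (lt_mem_nhds hi)] with k hk _ using hk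
    · exact Eventually.of_forall fun k hk => absurd hk hi
  filter_upwards [h1, hh] with k hk1 hk2
  have hsub : Finset.univ.filter (fun i => 0 < us i) ⊆ Finset.univ.filter (fun i => 0 < u k i) := by
    intro i
    simpa using hk1 i
  have hcard : (Finset.univ.filter (fun i => 0 < u k i)).card
      ≤ (Finset.univ.filter (fun i => 0 < us i)).card := by
    unfold h at hk2
    exact Nat.lt_succ_iff.1 (by exact_mod_cast hk2)
  have heq := Finset.eq_of_subset_of_card_le hsub hcard
  refine ⟨fun i hi => ?_, by unfold h; rw [heq]⟩
  have : i ∈ Finset.univ.filter (fun i => 0 < us i) := by rw [heq]; simpa using hi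
  simpa using this

/-! ### Quadratic bound on the augmented Lagrangian -/

namespace COP

theorem sub_eq_of_gap_eq_zero {P : COP n m} {xs : E n} {us : E m} (hgaps : P.gap xs us = 0)
    (x : E n) (u : E m) : P.gap x u = Matrix.toEuclideanLin P.A (x - xs) - (u - us) := by
  rw [← sub_zero (P.gap x u), ← hgaps, map_sub]
  unfold gap
  abel

/-- At points whose distance to the limit is of the order of the residual `e`, the augmented
Lagrangian exceeds its limit at most by a multiple of `e ^ 2`. -/
theorem exists_augLagrangian_sub_le {P : COP n m} {sigma ell L : ℝ}
    (hf : SmoothWeaklyConvex P.f sigma ell L) {xs : E n} {us ys : E m}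
    (hgaps : P.gap xs us = 0) {rho : ℝ} (hrho : 0 ≤ rho)
    {ι : Type*} {F : Filter ι} {x : ι → E n} {u y : ι → E m} {e : ι → ℝ}
    (hu : Tendsto u F (𝓝 us)) (hy : Tendsto y F (𝓝 ys))
    (he : Tendsto e F (𝓝 0)) {a C : ℝ}
    (hx : ∀ᶠ k in F, ‖x k - xs‖ ≤ C * e k)
    (hgap : ∀ᶠ k in F, ‖P.gap (x k) (u k)‖ ≤ a * e k)
    (hstat : ∀ᶠ k in F,
      ‖gradient P.f (x k) + Matrix.toEuclideanLin P.A.transpose (y k)‖ ≤ a * e k)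
    (hcomp : ∀ᶠ k in F, ∀ i, |u k i| ≤ a * e k ^ 2 ∨ |y k i| ≤ a * e k ^ 2)
    (hh : ∀ᶠ k in F, h (u k) = h us) :
    ∃ C', ∀ᶠ k in F, P.augLagrangian rho (x k) (u k) (y k) - P.augLagrangian rho xs us ys
      ≤ C' * e k ^ 2 := by
  -- If `us i = 0`, one factor is `O(e k ^ 2)` and the other bounded. If `us i ≠ 0`, then `u k i`
  -- stays away from `0`, so `y k i` must be the small one.
  have hprod : ∀ᶠ k in F, ∀ i, |y k i * (u k i - us i)| ≤ (‖ys‖ + 1) * (a * e k ^ 2) := by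
    rw [eventually_all]
    intro i
    have hui := tendsto_apply hu i
    have hyi := tendsto_apply hy i
    have hyb : ∀ᶠ k in F, |y k i| ≤ ‖ys‖ + 1 := by
      filter_upwards [hyi.abs.eventually (gt_mem_nhds (lt_add_one _))] with k hk
      have := PiLp.norm_apply_le ys i
      rw [Real.norm_eq_abs] at this
      linarith
    have hub : ∀ᶠ k in F, |u k i - us i| ≤ 1 := by
      have h1 := (hui.sub_const (us i)).abs
      rw [sub_self, abs_zero] at h1
      exact (h1.eventually (gt_mem_nhds one_pos)).mono fun k hk => hk.le
    have hM : 1 ≤ ‖ys‖ + 1 := by linarith [norm_nonneg ys]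
    have hsnd : ∀ k, |u k i - us i| ≤ 1 → |y k i| ≤ a * e k ^ 2 →
        |y k i * (u k i - us i)| ≤ (‖ys‖ + 1) * (a * e k ^ 2) := by
      intro k h1 h2
      rw [abs_mul, mul_comm]
      have h3 := abs_nonneg (y k i)
      exact mul_le_mul (h1.trans hM) h2 h3 (by linarith)
    by_cases hi : us i = 0
    · filter_upwards [hcomp, hyb, hub] with k hk h1 h2
      rcases hk i with h3 | h3
      · rw [hi, sub_zero, abs_mul]
        exact mul_le_mul h1 h3 (abs_nonneg _) (by linarith)
      · exact hsnd k h2 h3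
    · have h1 := (he.pow 2).const_mul a
      rw [zero_pow two_ne_zero, mul_zero] at h1
      filter_upwards [hcomp, hub, h1.eventually_lt hui.abs (abs_pos.2 hi)] with k hk h2 h3
      exact hsnd k h2 ((hk i).resolve_left (not_le.2 h3))
  refine ⟨|ell| / 2 * C ^ 2 + a * C + m * ((‖ys‖ + 1) * a) + rho / 2 * a ^ 2, ?_⟩
  filter_upwards [hx, hgap, hstat, hprod, hh] with k h1 h2 h3 h4 h5
  -- The expansion is based at `x k`, not at the limit, so that the gradient in the stationarity
  -- residual appears.
  have hlow := neg_le_of_abs_le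
    (abs_sub_inner_gradient_le hf.hasGradientAt hf.lipGradient (x k) xs)
  rw [← neg_sub (x k) xs, norm_neg, inner_neg_right] at hlow
  have hquad : ell / 2 * ‖x k - xs‖ ^ 2 ≤ |ell| / 2 * (C * e k) ^ 2 := by
    calc ell / 2 * ‖x k - xs‖ ^ 2 ≤ |ell| / 2 * ‖x k - xs‖ ^ 2 := by
          gcongr; exact le_abs_self ell
      _ ≤ _ := by gcongr
  have hres : inner ℝ (gradient P.f (x k)) (x k - xs) + inner ℝ (y k) (P.gap (x k) (u k))
      = inner ℝ (gradient P.f (x k) + Matrix.toEuclideanLin P.A.transpose (y k)) (x k - xs)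
        - inner ℝ (y k) (u k - us) := by
    rw [sub_eq_of_gap_eq_zero hgaps, inner_sub_right (y k), inner_add_left,
      real_inner_comm _ (Matrix.toEuclideanLin P.A.transpose (y k)), ← inner_toEuclideanLin,
      real_inner_comm (y k)]
    ring
  have hres1 : inner ℝ (gradient P.f (x k) + Matrix.toEuclideanLin P.A.transpose (y k)) (x k - xs)
      ≤ (a * e k) * (C * e k) :=
    (real_inner_le_norm _ _).trans
      (mul_le_mul h3 h1 (norm_nonneg _) ((norm_nonneg _).trans h3))
  have hres2 : -inner ℝ (y k) (u k - us) ≤ m * ((‖ys‖ + 1) * (a * e k ^ 2)) := by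
    rw [PiLp.inner_apply, ← Finset.sum_neg_distrib]
    refine (Finset.sum_le_card_nsmul _ _ ((‖ys‖ + 1) * (a * e k ^ 2)) fun i _ => ?_).trans ?_
    · refine le_trans (neg_le_abs _) ?_
      have := h4 i
      simpa [mul_comm] using this
    · simp
  have hgap2 : rho / 2 * ‖P.gap (x k) (u k)‖ ^ 2 ≤ rho / 2 * (a * e k) ^ 2 := by gcongr
  unfold augLagrangian
  rw [hgaps, h5, inner_zero_right, norm_zero]
  nlinarith

/-! ### Multiplier control and sufficient decrease -/

/-- Two consecutive outer iterations control the change of the multiplier. -/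
theorem StepBounds.norm_multiplier_sub_le {P : COP n m} {S : Params} {sigma ell L gamma : ℝ}
    (hf : SmoothWeaklyConvex P.f sigma ell L) (hmu : 0 ≤ S.mu) (hgamma : 0 < gamma)
    (hinj : ∀ v : E m, gamma * ‖v‖ ≤ ‖Matrix.toEuclideanLin P.A.transpose v‖)
    {eps₁ eps₂ : ℝ} {x₀ x₁ x₂ : E n} {u₀ u₁ u₂ y₀ y₁ y₂ : E m}
    (h₁ : P.StepBounds S eps₁ x₀ u₀ y₀ x₁ u₁ y₁) (h₂ : P.StepBounds S eps₂ x₁ u₁ y₁ x₂ u₂ y₂) :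
    ‖y₂ - y₁‖ ≤ (S.mu + ell + S.c1) / gamma * ‖x₂ - x₁‖
      + (S.mu + S.c1) / gamma * ‖x₁ - x₀‖ := by
  have h3 : Matrix.toEuclideanLin P.A.transpose (y₂ - y₁)
      = (gradient P.f x₂ + Matrix.toEuclideanLin P.A.transpose y₂ + S.mu • (x₂ - x₁))
        - (gradient P.f x₁ + Matrix.toEuclideanLin P.A.transpose y₁ + S.mu • (x₁ - x₀))
        - (gradient P.f x₂ - gradient P.f x₁) - S.mu • (x₂ - x₁) + S.mu • (x₁ - x₀) := by
    rw [map_sub]; abel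
  have h4 : ‖Matrix.toEuclideanLin P.A.transpose (y₂ - y₁)‖
      ≤ S.c1 * ‖x₂ - x₁‖ + S.c1 * ‖x₁ - x₀‖ + ell * ‖x₂ - x₁‖ + S.mu * ‖x₂ - x₁‖
        + S.mu * ‖x₁ - x₀‖ := by
    rw [h3]
    refine norm_add_le_of_le (norm_sub_le_of_le (norm_sub_le_of_le (norm_sub_le_of_le
      h₂.stationary h₁.stationary) (hf.lipGradient _ _)) ?_) ?_
    · rw [norm_smul, Real.norm_of_nonneg hmu]
    · rw [norm_smul, Real.norm_of_nonneg hmu]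
  have h5 := (hinj (y₂ - y₁)).trans h4
  rw [div_mul_eq_mul_div, div_mul_eq_mul_div, ← add_div, le_div_iff₀ hgamma]
  linarith

/-- The price of the dual step: `⟨y' - y, gap⟩ = rho * ‖gap‖² = ‖y' - y‖² / rho`. -/
theorem augLagrangian_multiplier (P : COP n m) (rho : ℝ) (x : E n) (u y y' : E m)
    (hy : y' = y + rho • P.gap x u) (hrho : 0 < rho) :
    P.augLagrangian rho x u y' = P.augLagrangian rho x u y + ‖y' - y‖ ^ 2 / rho := by
  subst hy
  unfold augLagrangian
  rw [inner_add_left, inner_smul_left, real_inner_self_eq_norm_sq, add_sub_cancel_left, norm_smul,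
    Real.norm_of_nonneg hrho.le]
  simp only [conj_trivial]
  field_simp
  ring

/-- The sufficient decrease of the Lyapunov function. -/
theorem StepBounds.lyapunov_add_le {P : COP n m} {S : Params} {c3 c4 beta : ℝ}
    (hmu : 0 < S.mu) (hrho0 : 0 < S.rho) (hrho : 8 * (c3 ^ 2 + c4 ^ 2) / S.mu < S.rho)
    (hbeta : beta = 4 * c4 ^ 2 / S.rho)
    {eps : ℝ} {x₀ x₁ x₂ : E n} {u₁ u₂ y₁ y₂ : E m}
    (h₂ : P.StepBounds S eps x₁ u₁ y₁ x₂ u₂ y₂)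
    (hy : ‖y₂ - y₁‖ ≤ c3 * ‖x₂ - x₁‖ + c4 * ‖x₁ - x₀‖) :
    P.lyapunov S.rho beta x₂ u₂ y₂ x₁ + S.mu / 4 * ‖x₂ - x₁‖ ^ 2
      ≤ P.lyapunov S.rho beta x₁ u₁ y₁ x₀ := by
  have h1 := h₂.descent
  unfold lyapunov
  rw [P.augLagrangian_multiplier S.rho x₂ u₂ y₁ y₂ h₂.multiplier hrho0]
  rw [div_lt_iff₀ hmu] at hrho
  have h3 : ‖y₂ - y₁‖ ^ 2 ≤ 2 * c3 ^ 2 * ‖x₂ - x₁‖ ^ 2 + 2 * c4 ^ 2 * ‖x₁ - x₀‖ ^ 2 := by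
    have := pow_le_pow_left₀ (norm_nonneg _) hy 2
    nlinarith [sq_nonneg (c3 * ‖x₂ - x₁‖ - c4 * ‖x₁ - x₀‖)]
  -- The choice of `beta` makes `2 * c4² / rho` equal to `beta / 2`, matching the older step. The
  -- newer step has total coefficient `2 * (c3² + c4²) / rho`, below `mu / 4`: half of the available
  -- decrease remains.
  have h4 : ‖y₂ - y₁‖ ^ 2 / S.rho + beta / 2 * ‖x₂ - x₁‖ ^ 2
      ≤ S.mu / 4 * ‖x₂ - x₁‖ ^ 2 + beta / 2 * ‖x₁ - x₀‖ ^ 2 := by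
    have h5 : S.rho * beta = 4 * c4 ^ 2 := by rw [hbeta]; field_simp
    have h6 : S.rho * (‖y₂ - y₁‖ ^ 2 / S.rho) = ‖y₂ - y₁‖ ^ 2 := by field_simp
    refine le_of_mul_le_mul_left ?_ hrho0
    rw [mul_add, h6, mul_add,
      show S.rho * (beta / 2 * ‖x₂ - x₁‖ ^ 2) = (S.rho * beta) / 2 * ‖x₂ - x₁‖ ^ 2 by ring,
      show S.rho * (beta / 2 * ‖x₁ - x₀‖ ^ 2) = (S.rho * beta) / 2 * ‖x₁ - x₀‖ ^ 2 by ring, h5]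
    have h7 := mul_le_mul_of_nonneg_right hrho.le (sq_nonneg ‖x₂ - x₁‖)
    nlinarith
  linarith

/-! ### The outer sequence: vanishing steps, residuals, convergence, rate -/

/-- The assumptions on the problem and the parameters that the analysis of the outer iteration
uses. -/
structure OuterParams (P : COP n m) (S : Params) (sigma ell L gamma c3 c4 beta : ℝ) : Prop where
  smooth : SmoothWeaklyConvex P.f sigma ell L
  lam_pos : 0 < P.lam
  alpha_pos : 0 < S.alpha
  mu_pos : 0 < S.mu
  rho_pos : 0 < S.rho
  c1_pos : 0 < S.c1
  c2_pos : 0 < S.c2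
  eps_lim : Tendsto S.eps atTop (𝓝 0)
  gamma_pos : 0 < gamma
  le_norm_transpose : ∀ v : E m, gamma * ‖v‖ ≤ ‖Matrix.toEuclideanLin P.A.transpose v‖
  c3_eq : c3 = (S.mu + ell + S.c1) / gamma
  c4_eq : c4 = (S.mu + S.c1) / gamma
  rho_gt : 8 * (c3 ^ 2 + c4 ^ 2) / S.mu < S.rho
  beta_eq : beta = 4 * c4 ^ 2 / S.rho

/-- A sequence of outer iterations, with one of its cluster points. -/
structure OuterRun (P : COP n m) (S : Params) (x : ℕ → E n) (u y : ℕ → E m)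
    (xs : E n) (us ys : E m) : Prop where
  step : ∀ k, P.StepBounds S (S.eps k) (x k) (u k) (y k) (x (k + 1)) (u (k + 1)) (y (k + 1))
  cluster : MapClusterPt (xs, us, ys) atTop (fun k => (x k, u k, y k))

theorem tendsto_gap (P : COP n m) {ι : Type*} {F : Filter ι} {x : ι → E n} {u : ι → E m}
    {xs : E n} {us : E m} (hx : Tendsto x F (𝓝 xs)) (hu : Tendsto u F (𝓝 us)) :
    Tendsto (fun k => P.gap (x k) (u k)) F (𝓝 (P.gap xs us)) := by
  have h1 : Tendsto (fun k => Matrix.toEuclideanLin P.A (x k)) F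
      (𝓝 (Matrix.toEuclideanLin P.A xs)) :=
    ((Matrix.toEuclideanLin P.A).continuous_of_finiteDimensional.tendsto xs).comp hx
  exact (h1.add_const P.b).sub hu

variable {P : COP n m} {S : Params} {sigma ell L gamma c3 c4 beta : ℝ}
  {x : ℕ → E n} {u y : ℕ → E m} {xs : E n} {us ys : E m}

/-- The indices that tend to infinity while the iterates tend to the given point. -/
def nearFilter (x : ℕ → E n) (u y : ℕ → E m) (xs : E n) (us ys : E m) : Filter ℕ :=
  atTop ⊓ comap (fun k => (x k, u k, y k)) (𝓝 (xs, us, ys))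

/-- The sum of the lengths of the last two steps. -/
noncomputable def lastSteps (x : ℕ → E n) (k : ℕ) : ℝ := ‖x k - x (k - 1)‖ + ‖x (k - 1) - x (k - 2)‖

theorem lastSteps_nonneg (x : ℕ → E n) (k : ℕ) : 0 ≤ lastSteps x k := by
  unfold lastSteps; positivity

theorem le_lastSteps (x : ℕ → E n) (k : ℕ) : ‖x k - x (k - 1)‖ ≤ lastSteps x k :=
  le_add_of_nonneg_right (norm_nonneg _)

theorem nearFilter_le_atTop : nearFilter x u y xs us ys ≤ atTop := inf_le_left

theorem tendsto_nearFilter :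
    Tendsto (fun k => (x k, u k, y k)) (nearFilter x u y xs us ys) (𝓝 (xs, us, ys)) :=
  tendsto_comap.mono_left inf_le_right

theorem OuterRun.neBot_nearFilter (hr : P.OuterRun S x u y xs us ys) :
    (nearFilter x u y xs us ys).NeBot := by
  unfold nearFilter
  rw [neBot_inf_comap_iff_map, inf_comm]
  exact hr.cluster

theorem OuterRun.stepBounds (hr : P.OuterRun S x u y xs us ys) {k : ℕ} (hk : 1 ≤ k) :
    P.StepBounds S (S.eps (k - 1)) (x (k - 1)) (u (k - 1)) (y (k - 1)) (x k) (u k) (y k) := by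
  obtain ⟨j, rfl⟩ := Nat.exists_eq_add_of_le' hk
  exact hr.step j

theorem OuterRun.norm_multiplier_sub_le (hP : P.OuterParams S sigma ell L gamma c3 c4 beta)
    (hr : P.OuterRun S x u y xs us ys) {k : ℕ} (hk : 1 ≤ k) :
    ‖y (k + 1) - y k‖ ≤ c3 * ‖x (k + 1) - x k‖ + c4 * ‖x k - x (k - 1)‖ := by
  rw [hP.c3_eq, hP.c4_eq]
  exact (hr.stepBounds hk).norm_multiplier_sub_le hP.smooth hP.mu_pos.le hP.gamma_pos
    hP.le_norm_transpose (hr.step k)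

theorem OuterRun.lyapunov_add_le (hP : P.OuterParams S sigma ell L gamma c3 c4 beta)
    (hr : P.OuterRun S x u y xs us ys) {k : ℕ} (hk : 1 ≤ k) :
    P.lyapunov S.rho beta (x (k + 1)) (u (k + 1)) (y (k + 1)) (x k)
        + S.mu / 4 * ‖x (k + 1) - x k‖ ^ 2
      ≤ P.lyapunov S.rho beta (x k) (u k) (y k) (x (k - 1)) :=
  (hr.step k).lyapunov_add_le hP.mu_pos hP.rho_pos hP.rho_gt hP.beta_eq
    (hr.norm_multiplier_sub_le hP hk)

/-- The index is shifted by one so that the truncated `k - 1` at `k = 0` never enters. -/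
theorem OuterRun.antitone_lyapunov (hP : P.OuterParams S sigma ell L gamma c3 c4 beta)
    (hr : P.OuterRun S x u y xs us ys) :
    Antitone fun j => P.lyapunov S.rho beta (x (j + 1)) (u (j + 1)) (y (j + 1)) (x j) := by
  refine antitone_nat_of_succ_le fun j => ?_
  have h1 := hr.lyapunov_add_le hP (Nat.le_add_left 1 j)
  have h2 : 0 ≤ S.mu / 4 * ‖x (j + 1 + 1) - x (j + 1)‖ ^ 2 := by
    have := hP.mu_pos; positivity
  simp only [Nat.add_sub_cancel] at h1
  linarith

theorem OuterParams.beta_nonneg (hP : P.OuterParams S sigma ell L gamma c3 c4 beta) :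
    0 ≤ beta := by
  have := hP.rho_pos
  rw [hP.beta_eq]; positivity

/-- Dropping the nonnegative terms, among them the discontinuous `h`, leaves a lower bound
continuous in the iterate, which can be followed to the cluster point. -/
theorem OuterParams.le_lyapunov (hP : P.OuterParams S sigma ell L gamma c3 c4 beta)
    (x : E n) (u y : E m) (v : E n) :
    P.f x + inner ℝ y (P.gap x u) ≤ P.lyapunov S.rho beta x u y v := by
  have h1 := hP.rho_pos
  have h2 := hP.beta_nonneg
  have h3 := mul_nonneg hP.lam_pos.le (h_nonneg u)
  have h4 : 0 ≤ S.rho / 2 * ‖P.gap x u‖ ^ 2 := by positivity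
  have h5 : 0 ≤ beta / 2 * ‖x - v‖ ^ 2 := by positivity
  unfold lyapunov augLagrangian
  linarith

theorem OuterRun.bddBelow_lyapunov (hP : P.OuterParams S sigma ell L gamma c3 c4 beta)
    (hr : P.OuterRun S x u y xs us ys) :
    BddBelow (Set.range fun j =>
      P.lyapunov S.rho beta (x (j + 1)) (u (j + 1)) (y (j + 1)) (x j)) := by
  have hne := hr.neBot_nearFilter
  have hz := tendsto_nearFilter (x := x) (u := u) (y := y) (xs := xs) (us := us) (ys := ys)
  have hx : Tendsto x (nearFilter x u y xs us ys) (𝓝 xs) := hz.fst_nhds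
  have hu : Tendsto u (nearFilter x u y xs us ys) (𝓝 us) := hz.snd_nhds.fst_nhds
  have hy : Tendsto y (nearFilter x u y xs us ys) (𝓝 ys) := hz.snd_nhds.snd_nhds
  have hfx : Tendsto (fun k => P.f (x k)) (nearFilter x u y xs us ys) (𝓝 (P.f xs)) :=
    (hP.smooth.contDiff.continuous.tendsto xs).comp hx
  have hlim : Tendsto (fun k => P.f (x k) + inner ℝ (y k) (P.gap (x k) (u k)))
      (nearFilter x u y xs us ys) (𝓝 (P.f xs + inner ℝ ys (P.gap xs us))) :=
    hfx.add (hy.inner (P.tendsto_gap hx hu))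
  have hev : ∀ᶠ k in nearFilter x u y xs us ys,
      P.f xs + inner ℝ ys (P.gap xs us) - 1 < P.f (x k) + inner ℝ (y k) (P.gap (x k) (u k)) :=
    hlim.eventually (lt_mem_nhds (sub_one_lt _))
  have hanti := hr.antitone_lyapunov hP
  refine ⟨P.f xs + inner ℝ ys (P.gap xs us) - 1, Set.forall_mem_range.2 fun j => ?_⟩
  -- Some later index lies near the cluster point; its value bounds the `j`-th one from below by
  -- monotonicity.
  obtain ⟨k, hk, hjk⟩ := (hev.and (nearFilter_le_atTop (eventually_ge_atTop (j + 1)))).exists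
  have hk1 : k - 1 + 1 = k := Nat.sub_add_cancel ((Nat.le_add_left 1 j).trans hjk)
  have h1 := hanti (Nat.le_sub_of_add_le hjk)
  have h2 := hP.le_lyapunov (x k) (u k) (y k) (x (k - 1))
  simp only [hk1] at h1
  exact (hk.le.trans h2).trans h1

theorem OuterRun.sq_norm_step_le (hP : P.OuterParams S sigma ell L gamma c3 c4 beta)
    (hr : P.OuterRun S x u y xs us ys) {k : ℕ} (hk : 1 ≤ k) :
    ‖x (k + 1) - x k‖ ^ 2 ≤ 4 / S.mu *
      (P.lyapunov S.rho beta (x k) (u k) (y k) (x (k - 1))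
        - P.lyapunov S.rho beta (x (k + 1)) (u (k + 1)) (y (k + 1)) (x k)) := by
  have h1 := hr.lyapunov_add_le hP hk
  rw [div_mul_eq_mul_div, le_div_iff₀ hP.mu_pos]
  linarith

/-- The steps of the `x`-iterates vanish. -/
theorem OuterRun.tendsto_step (hP : P.OuterParams S sigma ell L gamma c3 c4 beta)
    (hr : P.OuterRun S x u y xs us ys) :
    Tendsto (fun k => ‖x (k + 1) - x k‖) atTop (𝓝 0) := by
  have hconv := tendsto_atTop_ciInf (hr.antitone_lyapunov hP) (hr.bddBelow_lyapunov hP)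
  have hdiff := (hconv.sub ((tendsto_add_atTop_iff_nat 1).2 hconv)).const_mul (4 / S.mu)
  rw [sub_self, mul_zero] at hdiff
  have hsq : Tendsto (fun j => ‖x (j + 1 + 1) - x (j + 1)‖ ^ 2) atTop (𝓝 0) :=
    squeeze_zero (fun j => sq_nonneg _)
      (fun j => hr.sq_norm_step_le hP (Nat.le_add_left 1 j)) hdiff
  have hroot := (Real.continuous_sqrt.tendsto 0).comp hsq
  rw [Real.sqrt_zero] at hroot
  rw [← tendsto_add_atTop_iff_nat 1]
  refine hroot.congr fun j => ?_
  exact Real.sqrt_sq (norm_nonneg _)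

theorem OuterRun.tendsto_lastSteps (hP : P.OuterParams S sigma ell L gamma c3 c4 beta)
    (hr : P.OuterRun S x u y xs us ys) : Tendsto (lastSteps x) atTop (𝓝 0) := by
  have h1 := hr.tendsto_step hP
  rw [← tendsto_add_atTop_iff_nat 2]
  have h2 := ((tendsto_add_atTop_iff_nat 1).2 h1).add h1
  rw [add_zero] at h2
  exact h2

/-- The residuals of the optimality system are of the order of the last two steps. -/
theorem OuterRun.exists_residual_bound (hP : P.OuterParams S sigma ell L gamma c3 c4 beta)
    (hr : P.OuterRun S x u y xs us ys) :
    ∃ a : ℝ, ∀ k, 2 ≤ k →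
      ‖P.gap (x k) (u k)‖ ≤ a * lastSteps x k ∧
      ‖gradient P.f (x k) + Matrix.toEuclideanLin P.A.transpose (y k)‖ ≤ a * lastSteps x k ∧
      (∀ i, |u k i| ≤ a * lastSteps x k ^ 2 ∨ |y k i| ≤ a * lastSteps x k ^ 2) ∧
      ‖y k - y (k - 1)‖ ≤ a * lastSteps x k := by
  have hmu := hP.mu_pos
  have hrho := hP.rho_pos
  have hc1 := hP.c1_pos
  have hc2 := hP.c2_pos
  have halpha := hP.alpha_pos
  have b1 : 0 ≤ S.rho⁻¹ * (|c3| + |c4|) := by positivity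
  have b2 : 0 ≤ |c3| + |c4| := by positivity
  have b3 : 0 ≤ S.c2 / S.alpha := by positivity
  -- The sum of all constants needed below, so that one `a` serves every residual.
  set a := S.rho⁻¹ * (|c3| + |c4|) + (S.c1 + S.mu) + S.c2 + S.c2 / S.alpha + (|c3| + |c4|) with ha
  refine ⟨a, fun k hk => ?_⟩
  have hs := hr.stepBounds (one_le_two.trans hk)
  have he := lastSteps_nonneg x k
  have hD := le_lastSteps x k
  set e := lastSteps x k with hedef
  have hy : ‖y k - y (k - 1)‖ ≤ (|c3| + |c4|) * e := by
    obtain ⟨j, rfl⟩ := Nat.exists_eq_add_of_le' hk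
    have h1 := hr.norm_multiplier_sub_le hP (Nat.le_add_left 1 j)
    refine h1.trans ?_
    have h2 : ‖x (j + 1) - x (j + 1 - 1)‖ ≤ e := le_add_of_nonneg_left (norm_nonneg _)
    rw [add_mul]
    gcongr
    · exact le_abs_self c3
    · exact hD
    · exact le_abs_self c4
  have hsq : S.c2 * ‖x k - x (k - 1)‖ ^ 2 ≤ S.c2 * e ^ 2 := by gcongr
  refine ⟨?_, ?_, fun i => ?_, ?_⟩
  · have h1 : P.gap (x k) (u k) = S.rho⁻¹ • (y k - y (k - 1)) := by
      rw [hs.multiplier, add_sub_cancel_left, smul_smul, inv_mul_cancel₀ hrho.ne', one_smul]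
    rw [h1, norm_smul, Real.norm_of_nonneg (inv_nonneg.2 hrho.le)]
    calc S.rho⁻¹ * ‖y k - y (k - 1)‖ ≤ S.rho⁻¹ * ((|c3| + |c4|) * e) := by gcongr
      _ = (S.rho⁻¹ * (|c3| + |c4|)) * e := by ring
      _ ≤ a * e := by gcongr; linarith
  · have h1 := norm_sub_le_of_le hs.stationary
      (norm_smul_le S.mu (x k - x (k - 1)))
    rw [add_sub_cancel_right, Real.norm_of_nonneg hmu.le] at h1
    refine h1.trans ?_
    calc S.c1 * ‖x k - x (k - 1)‖ + S.mu * ‖x k - x (k - 1)‖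
        = (S.c1 + S.mu) * ‖x k - x (k - 1)‖ := by ring
      _ ≤ (S.c1 + S.mu) * e := by gcongr
      _ ≤ a * e := by gcongr; linarith
  · rcases hs.complementary i with h1 | h1
    · left
      calc |u k i| ≤ S.c2 * e ^ 2 := h1.trans hsq
        _ ≤ a * e ^ 2 := by gcongr; linarith
    · right
      calc |y k i| ≤ S.c2 / S.alpha * e ^ 2 := by
            rw [div_mul_eq_mul_div, le_div_iff₀ halpha, mul_comm]
            exact h1.trans hsq
        _ ≤ a * e ^ 2 := by gcongr; linarith
  · calc ‖y k - y (k - 1)‖ ≤ (|c3| + |c4|) * e := hy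
      _ ≤ a * e := by gcongr; linarith

/-- The cluster point is feasible. -/
theorem OuterRun.gap_eq_zero (hP : P.OuterParams S sigma ell L gamma c3 c4 beta)
    (hr : P.OuterRun S x u y xs us ys) : P.gap xs us = 0 := by
  have hne := hr.neBot_nearFilter
  obtain ⟨a, ha⟩ := hr.exists_residual_bound hP
  have hz := tendsto_nearFilter (x := x) (u := u) (y := y) (xs := xs) (us := us) (ys := ys)
  have h1 := P.tendsto_gap hz.fst_nhds hz.snd_nhds.fst_nhds
  have h2 : Tendsto (fun k => P.gap (x k) (u k)) atTop (𝓝 0) := by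
    refine squeeze_zero_norm' ?_ (by simpa using (hr.tendsto_lastSteps hP).const_mul a)
    filter_upwards [eventually_ge_atTop 2] with k hk using (ha k hk).1
  exact tendsto_nhds_unique h1 (h2.mono_left nearFilter_le_atTop)

/-- The cluster point is stationary. -/
theorem OuterRun.stationary (hP : P.OuterParams S sigma ell L gamma c3 c4 beta)
    (hr : P.OuterRun S x u y xs us ys) :
    gradient P.f xs + Matrix.toEuclideanLin P.A.transpose ys = 0 := by
  have hne := hr.neBot_nearFilter
  obtain ⟨a, ha⟩ := hr.exists_residual_bound hP
  have hz := tendsto_nearFilter (x := x) (u := u) (y := y) (xs := xs) (us := us) (ys := ys)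
  have h1 := ((hP.smooth.continuous_gradient.tendsto xs).comp hz.fst_nhds).add
    (((Matrix.toEuclideanLin P.A.transpose).continuous_of_finiteDimensional.tendsto ys).comp
      hz.snd_nhds.snd_nhds)
  have h2 : Tendsto (fun k => gradient P.f (x k) + Matrix.toEuclideanLin P.A.transpose (y k))
      atTop (𝓝 0) := by
    refine squeeze_zero_norm' ?_ (by simpa using (hr.tendsto_lastSteps hP).const_mul a)
    filter_upwards [eventually_ge_atTop 2] with k hk using (ha k hk).2.1
  exact tendsto_nhds_unique h1 (h2.mono_left nearFilter_le_atTop)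

/-- Near the cluster point, the positive entries of `u` are those of the limit. -/
theorem OuterRun.eventually_pos_iff_and_h_eq (hP : P.OuterParams S sigma ell L gamma c3 c4 beta)
    (hr : P.OuterRun S x u y xs us ys) :
    ∀ᶠ k in nearFilter x u y xs us ys, (∀ i, 0 < u k i → 0 < us i) ∧ h (u k) = h us := by
  have hz := tendsto_nearFilter (x := x) (u := u) (y := y) (xs := xs) (us := us) (ys := ys)
  have hu := hz.snd_nhds.fst_nhds
  have hy := hz.snd_nhds.snd_nhds
  refine ZeroOneALM.eventually_pos_iff_and_h_eq hu ?_
  -- The iterate with index `k` passed the test of outer iteration `k - 1`.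
  have heps : Tendsto (fun k => S.eps (k - 1)) (nearFilter x u y xs us ys) (𝓝 0) :=
    (hP.eps_lim.comp (tendsto_sub_atTop_nat 1)).mono_left nearFilter_le_atTop
  have hlim := (heps.add ((((tendsto_const_nhds (x := us)).sub
    (hu.add (hy.const_smul S.alpha))).norm.pow 2).const_mul (1 / 2))).sub
      ((hy.norm.pow 2).const_mul (S.alpha ^ 2 / 2))
  have hval : 0 + 1 / 2 * ‖us - (us + S.alpha • ys)‖ ^ 2 - S.alpha ^ 2 / 2 * ‖ys‖ ^ 2 = 0 := by
    rw [sub_add_cancel_left, norm_neg, norm_smul, mul_pow, Real.norm_eq_abs, sq_abs]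
    ring
  rw [hval] at hlim
  have hc := mul_pos hP.alpha_pos hP.lam_pos
  filter_upwards [hlim.eventually (gt_mem_nhds hc),
    nearFilter_le_atTop (eventually_ge_atTop 1)] with k hk hk1
  -- Testing the proximal inequality at `us` bounds `h (u k) - h us` by a null sequence divided by
  -- `alpha * lam`, eventually less than `1`.
  have h1 := (hr.stepBounds hk1).proximal us
  refine lt_of_mul_lt_mul_left ?_ hc.le
  linarith

/-- The iterates converge to the cluster point, at a rate bounded by the last two steps. -/
theorem OuterRun.tendsto_and_exists_norm_sub_le
    (hP : P.OuterParams S sigma ell L gamma c3 c4 beta)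
    (hr : P.OuterRun S x u y xs us ys) (hSOSC : P.SOSC xs us ys) :
    Tendsto (fun k => (x k, u k, y k)) atTop (𝓝 (xs, us, ys)) ∧
      ∃ C, ∀ᶠ k in atTop, ‖x k - xs‖ ≤ C * lastSteps x k := by
  obtain ⟨a, ha⟩ := hr.exists_residual_bound hP
  have hgaps := hr.gap_eq_zero hP
  have hstats := hr.stationary hP
  have he := hr.tendsto_lastSteps hP
  have hz := tendsto_nearFilter (x := x) (u := u) (y := y) (xs := xs) (us := us) (ys := ys)
  have h2 : ∀ᶠ k in nearFilter x u y xs us ys, 2 ≤ k :=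
    nearFilter_le_atTop (eventually_ge_atTop 2)
  obtain ⟨C, hC⟩ := hSOSC.exists_norm_sub_le (hP.smooth.hasFDerivAt_gradient xs) hgaps hstats
    hP.gamma_pos hP.le_norm_transpose hz.fst_nhds hz.snd_nhds.fst_nhds hz.snd_nhds.snd_nhds
    (he.mono_left nearFilter_le_atTop) (lastSteps_nonneg x)
    (h2.mono fun k hk => (ha k hk).1) (h2.mono fun k hk => (ha k hk).2.1)
    (h2.mono fun k hk => (ha k hk).2.2.1)
    ((hr.eventually_pos_iff_and_h_eq hP).mono fun k hk => hk.1)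
  set A' := LinearMap.toContinuousLinearMap (Matrix.toEuclideanLin P.A) with hA'
  have hApp : ∀ v, Matrix.toEuclideanLin P.A v = A' v := fun v => rfl
  -- The bound for `x` passes to `u` through the constraint and to `y` through stationarity, as `Aᵀ`
  -- is bounded below.
  have hdist : ∀ᶠ k in nearFilter x u y xs us ys, dist (x k, u k, y k) (xs, us, ys)
      ≤ C * lastSteps x k + (‖A'‖ * (C * lastSteps x k) + a * lastSteps x k)
        + gamma⁻¹ * (a * lastSteps x k + |ell| * (C * lastSteps x k)) := by
    filter_upwards [hC, h2] with k hk hk2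
    obtain ⟨h3, h4, -, -⟩ := ha k hk2
    have hu : ‖u k - us‖ ≤ ‖A'‖ * (C * lastSteps x k) + a * lastSteps x k := by
      have h5 : u k - us = A' (x k - xs) - P.gap (x k) (u k) := by
        rw [sub_eq_of_gap_eq_zero hgaps, ← hApp]; abel
      rw [h5]
      exact norm_sub_le_of_le ((A'.le_opNorm _).trans (by gcongr)) h3
    have hy : ‖y k - ys‖ ≤ gamma⁻¹ * (a * lastSteps x k + |ell| * (C * lastSteps x k)) := by
      rw [le_inv_mul_iff₀ hP.gamma_pos]
      refine (hP.le_norm_transpose _).trans ?_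
      have h5 : Matrix.toEuclideanLin P.A.transpose (y k - ys)
          = (gradient P.f (x k) + Matrix.toEuclideanLin P.A.transpose (y k))
            - (gradient P.f (x k) - gradient P.f xs) := by
        rw [map_sub, eq_neg_of_add_eq_zero_left hstats]; abel
      rw [h5]
      refine norm_sub_le_of_le h4 ((hP.smooth.lipGradient _ _).trans ?_)
      gcongr
      exact le_abs_self ell
    have p1 := (norm_nonneg _).trans hk
    have p2 := (norm_nonneg _).trans hu
    have p3 := (norm_nonneg _).trans hy
    rw [Prod.dist_eq, Prod.dist_eq, dist_eq_norm, dist_eq_norm, dist_eq_norm]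
    exact max_le (by linarith) (max_le (by linarith) (by linarith))
  have hxstep : Tendsto (fun k => x (k + 1) - x k) atTop (𝓝 0) :=
    tendsto_zero_iff_norm_tendsto_zero.2 (hr.tendsto_step hP)
  have hystep : Tendsto (fun k => y (k + 1) - y k) atTop (𝓝 0) := by
    refine squeeze_zero_norm' (a := fun k => a * lastSteps x (k + 1)) ?_
      (by simpa using ((tendsto_add_atTop_iff_nat 1).2 he).const_mul a)
    filter_upwards [eventually_ge_atTop 1] with k hk
    simpa using (ha (k + 1) (by omega)).2.2.2
  have hgap : Tendsto (fun k => P.gap (x k) (u k)) atTop (𝓝 0) := by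
    refine squeeze_zero_norm' ?_ (by simpa using he.const_mul a)
    filter_upwards [eventually_ge_atTop 2] with k hk using (ha k hk).1
  have hustep : Tendsto (fun k => u (k + 1) - u k) atTop (𝓝 0) := by
    have h3 := (((A'.continuous.tendsto 0).comp hxstep).sub
      ((tendsto_add_atTop_iff_nat 1).2 hgap)).add hgap
    rw [map_zero, sub_zero, add_zero] at h3
    refine h3.congr fun k => ?_
    simp only [Function.comp_apply, map_sub, ← hApp, gap]
    abel
  have htend : Tendsto (fun k => (x k, u k, y k)) atTop (𝓝 (xs, us, ys)) := by
    refine tendsto_of_mapClusterPt_of_dist_le hr.cluster ?_ ?_ hdist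
    · have h3 := (hxstep.prodMk_nhds (hustep.prodMk_nhds hystep)).norm
      simp only [Prod.norm_mk, norm_zero, max_self] at h3
      refine h3.congr fun k => ?_
      rw [Prod.dist_eq, Prod.dist_eq, dist_eq_norm, dist_eq_norm, dist_eq_norm]
    · have h3 := ((he.const_mul C).add (((he.const_mul C).const_mul ‖A'‖).add
        (he.const_mul a))).add (((he.const_mul a).add
          ((he.const_mul C).const_mul |ell|)).const_mul gamma⁻¹)
      simpa using h3
  -- Once the whole sequence converges, nearness to the limit is no restriction on late indices.
  exact ⟨htend, C, hC.filter_mono (le_inf le_rfl (tendsto_iff_comap.1 htend))⟩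

/-- The R-linear convergence of the Lyapunov sequence. -/
theorem OuterRun.exists_lyapunov_bound (hP : P.OuterParams S sigma ell L gamma c3 c4 beta)
    (hr : P.OuterRun S x u y xs us ys) (hSOSC : P.SOSC xs us ys) :
    ∃ k_nu : ℕ, 1 ≤ k_nu ∧ ∃ c_nu q : ℝ, 0 < c_nu ∧ 0 < q ∧ q < 1 ∧
      ∀ k, k_nu ≤ k →
        0 ≤ P.lyapunov S.rho beta (x k) (u k) (y k) (x (k - 1))
            - P.lyapunov S.rho beta xs us ys xs ∧
        P.lyapunov S.rho beta (x k) (u k) (y k) (x (k - 1))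
            - P.lyapunov S.rho beta xs us ys xs ≤ c_nu * q ^ k := by
  obtain ⟨htend, C, hC⟩ := hr.tendsto_and_exists_norm_sub_le hP hSOSC
  obtain ⟨a, ha⟩ := hr.exists_residual_bound hP
  have hgaps := hr.gap_eq_zero hP
  have he := hr.tendsto_lastSteps hP
  have hx : Tendsto x atTop (𝓝 xs) := htend.fst_nhds
  have hu : Tendsto u atTop (𝓝 us) := htend.snd_nhds.fst_nhds
  have hy : Tendsto y atTop (𝓝 ys) := htend.snd_nhds.snd_nhds
  have hnear : atTop ≤ nearFilter x u y xs us ys := le_inf le_rfl (tendsto_iff_comap.1 htend)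
  have hh : ∀ᶠ k in atTop, h (u k) = h us :=
    ((hr.eventually_pos_iff_and_h_eq hP).filter_mono hnear).mono fun k hk => hk.2
  have h2 := eventually_ge_atTop 2
  obtain ⟨C', hC'⟩ := exists_augLagrangian_sub_le hP.smooth hgaps hP.rho_pos.le hu hy he hC
    (h2.mono fun k hk => (ha k hk).1) (h2.mono fun k hk => (ha k hk).2.1)
    (h2.mono fun k hk => (ha k hk).2.2.1) hh
  have hstar : P.lyapunov S.rho beta xs us ys xs = P.augLagrangian S.rho xs us ys := by
    simp [lyapunov]
  set v := fun k => P.lyapunov S.rho beta (x k) (u k) (y k) (x (k - 1))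
    - P.lyapunov S.rho beta xs us ys xs with hv
  have hbeta := hP.beta_nonneg
  have hmu := hP.mu_pos
  -- Although `h` is discontinuous, `h (u k)` is eventually constant, so the Lyapunov values
  -- converge to the value at the limit.
  have hvtend : Tendsto (fun j => v (j + 1)) atTop (𝓝 0) := by
    have hgap := P.tendsto_gap hx hu
    have h3 := ((((hP.smooth.contDiff.continuous.tendsto xs).comp hx).add (hy.inner hgap)).add
      ((hgap.norm.pow 2).const_mul (S.rho / 2))).add_const (P.lam * h us)
    have h4 := (tendsto_add_atTop_iff_nat 1).2 (h3.sub_const (P.lyapunov S.rho beta xs us ys xs))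
    have h5 := h4.add (((hr.tendsto_step hP).pow 2).const_mul (beta / 2))
    rw [hstar] at h5
    simp only [augLagrangian, sub_self, zero_add, ne_eq, OfNat.ofNat_ne_zero, not_false_eq_true,
      zero_pow, mul_zero] at h5
    refine h5.congr' ?_
    filter_upwards [(tendsto_add_atTop_nat 1).eventually hh] with j hj
    simp only [hv]
    rw [hstar]
    simp only [lyapunov, augLagrangian, hj, Function.comp_apply, Nat.add_sub_cancel]
    ring
  have hanti : Antitone fun j => v (j + 1) := fun i j hij =>
    sub_le_sub_right (hr.antitone_lyapunov hP hij) _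
  have hpos : ∀ k, 1 ≤ k → 0 ≤ v k := by
    intro k hk
    obtain ⟨j, rfl⟩ := Nat.exists_eq_add_of_le' hk
    exact hanti.le_of_tendsto hvtend j
  have hdesc : ∀ k, 1 ≤ k → S.mu / 4 * ‖x (k + 1) - x k‖ ^ 2 ≤ v k - v (k + 1) := by
    intro k hk
    have h3 := hr.lyapunov_add_le hP hk
    simp only [hv, Nat.add_sub_cancel]
    linarith
  obtain ⟨K, hK⟩ := eventually_atTop.1 hC'
  have hB : 0 < 2 * (|C'| + beta / 2 + 1) * (4 / S.mu) := by positivity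
  -- The excess at `k + 2` is `O(e²)`, where `e` involves the steps from `k` to `k + 2`; the
  -- sufficient decrease bounds their squares by `4 / mu * (v k - v (k + 2))`.
  obtain ⟨c, q, hc, hq0, hq1, hbound⟩ := exists_geometric_bound (a := v) (K := K + 1) hB (by
    intro k hk
    have h3 := hK (k + 2) (by omega)
    have h4 := hdesc k (by omega)
    have h5 := hdesc (k + 1) (by omega)
    have h6 := le_lastSteps x (k + 2)
    have h7 : lastSteps x (k + 2) ^ 2
        ≤ 2 * (‖x (k + 1 + 1) - x (k + 1)‖ ^ 2 + ‖x (k + 1) - x k‖ ^ 2) := add_sq_le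
    have h8 : ‖x (k + 2) - x (k + 2 - 1)‖ ^ 2 ≤ lastSteps x (k + 2) ^ 2 := by gcongr
    have h9 : v (k + 2) ≤ (|C'| + beta / 2 + 1) * lastSteps x (k + 2) ^ 2 := by
      have h10 := mul_le_mul_of_nonneg_left h8 (div_nonneg hbeta zero_le_two)
      have h11 := mul_le_mul_of_nonneg_right (le_abs_self C') (sq_nonneg (lastSteps x (k + 2)))
      have h12 := sq_nonneg (lastSteps x (k + 2))
      simp only [hv]
      rw [hstar]
      unfold lyapunov
      linarith
    have h13 : ‖x (k + 1 + 1) - x (k + 1)‖ ^ 2 + ‖x (k + 1) - x k‖ ^ 2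
        ≤ 4 / S.mu * (v k - v (k + 2)) := by
      rw [div_mul_eq_mul_div, le_div_iff₀ hmu]
      have h14 : v (k + 1 + 1) = v (k + 2) := rfl
      linarith
    calc v (k + 2) ≤ (|C'| + beta / 2 + 1) * lastSteps x (k + 2) ^ 2 := h9
      _ ≤ (|C'| + beta / 2 + 1) * (2 * (4 / S.mu * (v k - v (k + 2)))) := by
        gcongr
        linarith
      _ = _ := by ring)
  exact ⟨K + 1, by omega, c, q, hc, hq0, hq1, fun k hk => ⟨hpos k (by omega), hbound k hk⟩⟩

end COP

end ZeroOneALM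

/-! ### Reduction of the theorem to the outer sequence -/

theorem mainTheorem10 {n m : ℕ} (P : COP n m) (S : Params)
    (hlam : 0 < P.lam)
    -- smoothness, weak convexity and coerciveness of the objective
    (sigma_f ell_f L_f : ℝ) (hf : SmoothWeaklyConvex P.f sigma_f ell_f L_f)
    (hcoercive : Filter.Tendsto P.f (Bornology.cobounded (E n)) Filter.atTop)
    -- full row rank, and the smallest eigenvalue of `A Aᵀ`
    (hA : P.A.rank = m) (gamma : ℝ) (hgamma : 0 < gamma)
    (hgamma_sq : IsLeast
      {r : ℝ | Module.End.HasEigenvalue (Matrix.toLin' (P.A * P.A.transpose)) r} (gamma ^ 2))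
    -- parameters
    (hmu : 0 < S.mu) (hmu_sigma : sigma_f < S.mu) (hsigmaG : S.sigmaG = S.mu - sigma_f)
    (hc1 : 0 < S.c1) (hc2 : 0 < S.c2)
    (heps : ∀ k, 0 < S.eps k) (heps_lim : Filter.Tendsto S.eps Filter.atTop (nhds 0))
    (c3 c4 beta : ℝ)
    (hc3 : c3 = (S.mu + ell_f + S.c1) / gamma) (hc4 : c4 = (S.mu + S.c1) / gamma)
    (hrho : max (8 * (c3 ^ 2 + c4 ^ 2) / S.mu) (4 * ell_f / gamma ^ 2) < S.rho)
    (hbeta : beta = 4 * c4 ^ 2 / S.rho)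
    (ell_g : ℝ) (hell_g : 0 < ell_g) (hlip : P.LipGradG S.rho S.mu ell_g)
    (halpha : 0 < S.alpha) (halpha_lt : S.alpha < 1 / ell_g)
    (ht : 0 < S.t) (ht_lt : S.t < 2 / ell_g)
    -- the generated sequence and an accumulation point that satisfies SOSC
    (x : ℕ → E n) (u y : ℕ → E m) (hgen : P.IsINALM S x u y)
    (xs : E n) (us ys : E m)
    (hacc : MapClusterPt (xs, us, ys) Filter.atTop (fun k => (x k, u k, y k)))
    (hSOSC : P.SOSC xs us ys) :
    ∃ k_nu : ℕ, 1 ≤ k_nu ∧ ∃ c_nu q : ℝ, 0 < c_nu ∧ 0 < q ∧ q < 1 ∧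
      ∀ k, k_nu ≤ k →
        0 ≤ P.lyapunov S.rho beta (x k) (u k) (y k) (x (k - 1))
            - P.lyapunov S.rho beta xs us ys xs ∧
        P.lyapunov S.rho beta (x k) (u k) (y k) (x (k - 1))
            - P.lyapunov S.rho beta xs us ys xs ≤ c_nu * q ^ k := by
  have hrho1 := (le_max_left _ _).trans_lt hrho
  have hrho0 : 0 < S.rho := lt_of_le_of_lt (by positivity) hrho1
  have hD : P.DescentParams S ell_g :=
    ⟨hlam, hlip, hell_g, halpha, halpha_lt, ht, ht_lt, by rw [hsigmaG]; linarith⟩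
  have hP : P.OuterParams S sigma_f ell_f L_f gamma c3 c4 beta :=
    ⟨hf, hlam, halpha, hmu, hrho0, hc1, hc2, heps_lim, hgamma,
      le_norm_transpose hgamma_sq, hc3, hc4, hrho1, hbeta⟩
  have hr : P.OuterRun S x u y xs us ys := ⟨hgen.stepBounds hf hD, hacc⟩
  exact hr.exists_lyapunov_bound hP hSOSC
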